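/- **Theorem 4.** Let $\mathcal V$ be a finite-dimensional real or complex vector space, let $\|\cdot\|$ be any norm on the space $L(\mathcal V)$ of linear endomorphisms of $\mathcal V$ (it need not be submultiplicative or induced by a norm on $\mathcal V$), and let $\mathcal T\in L(\mathcal V)$ generate a semigroup bounded by $C$, that is, $\|\mathcal T^k\|\le C$ for all integers $k\ge 0$. Let $$\mathcal T_\infty=\sum_{|\lambda|=1}\lambda\,\mathcal P_\lambda ,$$ where the sum runs over the distinct eigenvalues $\lambda$ of $\mathcal T$ of modulus one and $\mathcal P_\lambda$ is the spectral projection of $\mathcal T$ at $\lambda$ (the projection onto the generalized eigenspace at $\lambda$ along the sum of the other generalized eigenspaces). If $\mathcal V$ is real, eigenvalues and projections are those of the complexification of $\mathcal T$, and $\mathcal T_\infty$ is the endomorphism of $\mathcal V$ whose complexification is this sum. Let $m$ be the minimal polynomial of $\mathcal T-\mathcal T_\infty$, let $\lambda_1,\dots,\lambda_{|m|}$ be its complex zeros repeated according to multiplicity, so that $|m|$ is the number of linear factors of $m$ over $\mathbb C$, let $\mu=\max_i|\lambda_i|$ be the spectral radius of $\mathcal T-\mathcal T_\infty$, and let $$B(z)=\prod_{i=1}^{|m|}\frac{z-\lambda_i}{1-\overline{\lambda_i}\,z}$$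 be the Blaschke product associated with $m$. Assume $\mu>0$. Then for every natural number $n>\frac{\mu}{1-\mu}$, $$\|\mathcal T^n-\mathcal T_\infty^n\|\;\le\;\mu^{n+1}\,\frac{4Ce^2\sqrt{|m|}\,(|m|+1)}{n\left(1-\left(1+\frac1n\right)\mu\right)^{3/2}}\;\sup_{|z|=\mu(1+1/n)}\left|\frac1{B(z)}\right| .$$ -/

import Mathlib

open scoped TensorProduct ComplexConjugate

noncomputable section

namespace BoundedSemigroup

/-! ### Spectral projections over the complex numbers -/

section Complex

variable {W : Type*} [AddCommGroup W] [Module ℂ W] [FiniteDimensional ℂ W]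

theorem isCompl_maxGenEigenspace (T : Module.End ℂ W) (ν : ℂ) :
    IsCompl (T.maxGenEigenspace ν) (⨆ κ, ⨆ _ : κ ≠ ν, T.maxGenEigenspace κ) := by
  refine ⟨T.independent_maxGenEigenspace ν, ?_⟩
  rw [codisjoint_iff, eq_top_iff, ← Module.End.iSup_maxGenEigenspace_eq_top T]
  refine iSup_le fun κ => ?_
  by_cases h : κ = ν
  · rw [h]; exact le_sup_left
  · exact le_sup_of_le_right (le_iSup₂_of_le κ h le_rfl)

/-- The spectral projection of `T` at `ν`: the projection onto the generalized eigenspace at `ν`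
along the sum of all other generalized eigenspaces. It is zero when `ν` is not an eigenvalue. -/
def spectralProjection (T : Module.End ℂ W) (ν : ℂ) : Module.End ℂ W :=
  Submodule.projection _ _ (isCompl_maxGenEigenspace T ν)

/-- `∑ ν • P_ν`, over the eigenvalues `ν` of `T` of modulus one, with `P_ν` the spectral
projections. -/
def peripheralPart (T : Module.End ℂ W) : Module.End ℂ W :=
  ∑ ν ∈ T.finite_hasEigenvalue.toFinset with ‖ν‖ = 1, ν • spectralProjection T ν

end Complex

/-! ### Real and complex scalars -/

section Scalars

variable (𝕜 : Type*) [RCLike 𝕜]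

/-- The inclusion of the scalar field (`ℝ` or `ℂ`) into `ℂ`. -/
def toComplex : 𝕜 →+* ℂ where
  toFun z := RCLike.map 𝕜 ℂ z
  map_one' := by simp
  map_zero' := by simp
  map_add' x y := map_add _ x y
  map_mul' x y := by
    obtain h | h := RCLike.I_eq_zero_or_im_I_eq_one (K := 𝕜)
    · simp [RCLike.im_eq_zero h]
    · apply Complex.ext <;> simp

/-- `ℂ` as an algebra over the scalar field. -/
abbrev complexAlgebra : Algebra 𝕜 ℂ := (toComplex 𝕜).toAlgebra

/-- The retraction of `ℂ` onto the scalar field: the real part if the field is `ℝ`, the identity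
if it is `ℂ`. -/
def ofComplex : letI := complexAlgebra 𝕜; ℂ →ₗ[𝕜] 𝕜 :=
  letI := complexAlgebra 𝕜
  { toFun := fun z => RCLike.map ℂ 𝕜 z
    map_add' := fun x y => map_add _ x y
    map_smul' := fun a z => by
      rw [Algebra.smul_def]
      change RCLike.map ℂ 𝕜 (RCLike.map 𝕜 ℂ a * z) = a * RCLike.map ℂ 𝕜 z
      obtain h | h := RCLike.I_eq_zero_or_im_I_eq_one (K := 𝕜)
      · apply RCLike.ext <;> simp [RCLike.im_eq_zero h]
      · apply RCLike.ext <;> simp [h] }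

end Scalars

/-! ### Spectral data of an endomorphism of a real or complex vector space -/

section Spectral

variable {𝕜 : Type*} [RCLike 𝕜] {V : Type*} [AddCommGroup V] [Module 𝕜 V]

/-- The spectral radius: the largest modulus of the complex eigenvalues, that is, of the
eigenvalues of the complexification. -/
def specRadius (A : Module.End 𝕜 V) : ℝ :=
  letI := complexAlgebra 𝕜
  (spectralRadius ℂ (A.baseChange ℂ : Module.End ℂ (ℂ ⊗[𝕜] V))).toReal

/-- The complex zeros of the minimal polynomial, with multiplicities. -/
def minpolyRoots (A : Module.End 𝕜 V) : Multiset ℂ :=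
  ((minpoly 𝕜 A).map (toComplex 𝕜)).roots

/-- The number of linear factors of the minimal polynomial over `ℂ`. -/
def numLinearFactors (A : Module.End 𝕜 V) : ℕ := (minpolyRoots A).card

/-- The Blaschke product associated with the minimal polynomial. -/
def blaschke (A : Module.End 𝕜 V) (z : ℂ) : ℂ :=
  ((minpolyRoots A).map fun ν => (z - ν) / (1 - conj ν * z)).prod

/-- The asymptotic part `T_∞ = ∑ ν • P_ν` of `T`, over the eigenvalues `ν` of modulus one. The sum
is formed on the complexification. In the real case it commutes with complex conjugation, hence
maps `V` to itself; the retraction of the complexification onto `V` serves to read it as an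
endomorphism of `V`. -/
def asymptoticPart [FiniteDimensional 𝕜 V] (T : Module.End 𝕜 V) : Module.End 𝕜 V :=
  letI := complexAlgebra 𝕜
  (TensorProduct.lid 𝕜 V).toLinearMap ∘ₗ (ofComplex 𝕜).rTensor V ∘ₗ
    (peripheralPart (T.baseChange ℂ : Module.End ℂ (ℂ ⊗[𝕜] V))).restrictScalars 𝕜 ∘ₗ
      TensorProduct.mk 𝕜 ℂ V 1

end Spectral

end BoundedSemigroup

end

noncomputable section

namespace BoundedSemigroup

/-! ### Power series with absolutely summable coefficients -/

section Wiener

open PowerSeries MeasureTheory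

/-! Put `A = T - Tinf`. The relations `T * Tinf = Tinf * T = Tinf * Tinf` give `A ^ k = T ^ k - Tinf
^ k` for `k ≥ 1`. Each `Tinf ^ m` with `m ≥ 1` is a limit of powers of `T`, so the powers of `A` are
bounded by `2 * C`. A functional that norms `A ^ n` (Hahn–Banach) turns them into a bounded scalar
sequence `x` obeying the linear recurrence of the minimal polynomial; the norm need not be
submultiplicative.

Let `b` be the Taylor series of the Blaschke product `B`. Its numerator is the characteristic
polynomial of the recurrence, so `∑ k, b_k * x_(k+t) = 0` for all `t`. The shifts of `b` are
orthonormal in `H²`; summing that relation against `x` removes everything except a tail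
(`norm_le_tsum_mul_tsum`): `|x_n| ≤ K * (∑ k, |b_(n+k+1)|) * (∑ k, |b_(k+1)|)`.

The second sum is `O(√(D / (1 - μ)))`, with `D` the number of zeros, by Cauchy–Schwarz on a circle
slightly larger than the unit circle, where `|B| ≤ e` (`sum_norm_coeff_blaschkeSeries_le`). For the
first, a Bernstein-type bound on single coefficients, `l * |b_l| ≤ r ^ l * D * sup_{|z| = r} |1 /
B|` (`norm_coeff_blaschkeSeries_le`), is summed geometrically with `r = μ * (1 + 1 / n)`. It rests
on `mul_norm_coeff_le_of_recurrence`: a Toeplitz matrix of rank at most `D` has trace at most `D`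
times its norm. -/

/-- The coefficients are absolutely summable. -/
def Wiener (f : PowerSeries ℂ) : Prop := Summable fun k => ‖coeff k f‖

/-- The sum of the series at `z`. -/
def wienerEval (f : PowerSeries ℂ) (z : ℂ) : ℂ := ∑' k, coeff k f * z ^ k

theorem Wiener.summable_eval {f : PowerSeries ℂ} (hf : Wiener f) {z : ℂ} (hz : ‖z‖ ≤ 1) :
    Summable fun k => ‖coeff k f * z ^ k‖ := by
  refine Summable.of_nonneg_of_le (fun _ => norm_nonneg _) (fun k => ?_) hf
  rw [norm_mul, norm_pow]
  exact mul_le_of_le_one_right (norm_nonneg _) (pow_le_one₀ (norm_nonneg _) hz)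

theorem Wiener.mul {f g : PowerSeries ℂ} (hf : Wiener f) (hg : Wiener g) : Wiener (f * g) := by
  have := summable_norm_sum_mul_antidiagonal_of_summable_norm hf hg
  simpa only [Wiener, coeff_mul] using this

theorem wienerEval_mul {f g : PowerSeries ℂ} (hf : Wiener f) (hg : Wiener g) {z : ℂ}
    (hz : ‖z‖ ≤ 1) : wienerEval (f * g) z = wienerEval f z * wienerEval g z := by
  have := tsum_mul_tsum_eq_tsum_sum_antidiagonal_of_summable_norm
    (hf.summable_eval hz) (hg.summable_eval hz)
  rw [wienerEval, wienerEval, wienerEval, this]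
  refine tsum_congr fun k => ?_
  rw [coeff_mul, Finset.sum_mul]
  refine Finset.sum_congr rfl fun p hp => ?_
  rw [← Finset.HasAntidiagonal.mem_antidiagonal.1 hp, pow_add]
  ring

theorem wiener_polynomial (p : Polynomial ℂ) : Wiener (p : PowerSeries ℂ) := by
  refine summable_of_ne_finset_zero (s := Finset.range (p.natDegree + 1)) fun k hk => ?_
  rw [Polynomial.coeff_coe, Polynomial.coeff_eq_zero_of_natDegree_lt, norm_zero]
  simpa [Nat.lt_succ_iff] using hk

theorem wienerEval_polynomial (p : Polynomial ℂ) (z : ℂ) :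
    wienerEval (p : PowerSeries ℂ) z = p.eval z := by
  rw [wienerEval, Polynomial.eval_eq_sum_range,
    tsum_eq_sum (s := Finset.range (p.natDegree + 1))]
  · simp only [Polynomial.coeff_coe]
  · intro k hk
    rw [Polynomial.coeff_coe, Polynomial.coeff_eq_zero_of_natDegree_lt, zero_mul]
    simpa [Nat.lt_succ_iff] using hk

theorem wiener_mk_pow {a : ℂ} (ha : ‖a‖ < 1) : Wiener (mk fun k => a ^ k) := by
  simpa [Wiener] using summable_geometric_of_lt_one (norm_nonneg a) ha

theorem wienerEval_mk_pow {a z : ℂ} (ha : ‖a‖ < 1) (hz : ‖z‖ ≤ 1) :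
    wienerEval (mk fun k => a ^ k) z = (1 - a * z)⁻¹ := by
  have : ‖a * z‖ < 1 := by
    rw [norm_mul]
    exact (mul_le_of_le_one_right (norm_nonneg _) hz).trans_lt ha
  simpa [wienerEval, ← mul_pow] using tsum_geometric_of_norm_lt_one this

theorem integral_exp_int_mul (m : ℤ) :
    ∫ θ in (0 : ℝ)..2 * Real.pi, Complex.exp (m * (θ * Complex.I)) =
      if m = 0 then (2 * Real.pi : ℂ) else 0 := by
  split_ifs with h
  · simp [h]
  · have hc : (m * Complex.I : ℂ) ≠ 0 := mul_ne_zero (by exact_mod_cast h) Complex.I_ne_zero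
    have := integral_exp_mul_complex (a := 0) (b := 2 * Real.pi) hc
    calc _ = ∫ θ in (0 : ℝ)..2 * Real.pi, Complex.exp (m * Complex.I * θ) := by
          congr 1; ext θ; ring_nf
      _ = 0 := by
          rw [this]
          have h2 : Complex.exp (m * Complex.I * ((2 * Real.pi : ℝ) : ℂ)) = 1 := by
            rw [← Complex.exp_int_mul_two_pi_mul_I m]; congr 1; push_cast; ring
          rw [h2]; simp

theorem hasSum_mul_conj {a b : ℕ → ℂ} (ha : Summable fun k => ‖a k‖)
    (hb : Summable fun k => ‖b k‖) :
    HasSum (fun p : ℕ × ℕ => a p.1 * conj (b p.2)) ((∑' k, a k) * conj (∑' k, b k)) := by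
  have hb' : Summable fun k => ‖conj (b k)‖ := by simpa only [RCLike.norm_conj] using hb
  have h2 : HasSum (fun k => conj (b k)) (conj (∑' k, b k)) :=
    hb.of_norm.hasSum.map (starRingEnd ℂ) Complex.continuous_conj
  have h1 : HasSum a (∑' k, a k) := ha.of_norm.hasSum
  have h3 : Summable fun p : ℕ × ℕ => a p.1 * conj (b p.2) :=
    summable_mul_of_summable_norm (f := a) (g := fun k => conj (b k)) ha hb'
  exact HasSum.mul (f := a) (g := fun k => conj (b k)) h1 h2 h3

theorem exp_int_sub_mul_I (k l : ℕ) (θ : ℝ) :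
    Complex.exp (((k : ℤ) - (l : ℤ) : ℤ) * (θ * Complex.I)) =
      Complex.exp (θ * Complex.I) ^ k * conj (Complex.exp (θ * Complex.I) ^ l) := by
  have hconj : conj (Complex.exp (θ * Complex.I)) = Complex.exp (-(θ * Complex.I)) := by
    rw [← Complex.exp_conj, map_mul, Complex.conj_ofReal, Complex.conj_I, mul_neg]
  rw [map_pow, hconj, ← Complex.exp_nat_mul, ← Complex.exp_nat_mul, ← Complex.exp_add]
  congr 1
  push_cast
  ring

/-- Parseval's identity on the unit circle. -/
theorem integral_wienerEval_mul_conj {f g : PowerSeries ℂ} (hf : Wiener f) (hg : Wiener g) :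
    ∫ θ in (0 : ℝ)..2 * Real.pi, wienerEval f (Complex.exp (θ * Complex.I)) *
        conj (wienerEval g (Complex.exp (θ * Complex.I))) =
      2 * Real.pi * ∑' k, coeff k f * conj (coeff k g) := by
  have hprod : Summable fun p : ℕ × ℕ => ‖coeff p.1 f‖ * ‖coeff p.2 g‖ :=
    Summable.mul_of_nonneg hf hg (fun _ => norm_nonneg _) (fun _ => norm_nonneg _)
  let F : ℕ × ℕ → ℝ → ℂ := fun p θ =>
    coeff p.1 f * conj (coeff p.2 g) * Complex.exp (((p.1 : ℤ) - (p.2 : ℤ) : ℤ) * (θ * Complex.I))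
  have hFnorm : ∀ p θ, ‖F p θ‖ = ‖coeff p.1 f‖ * ‖coeff p.2 g‖ := by
    intro p θ
    simp only [F]
    rw [exp_int_sub_mul_I, norm_mul, norm_mul, norm_mul, RCLike.norm_conj, RCLike.norm_conj,
      norm_pow, norm_pow, Complex.norm_exp_ofReal_mul_I, one_pow, one_pow, mul_one, mul_one]
  have hFsum : ∀ θ : ℝ, HasSum (fun p => F p θ)
      (wienerEval f (Complex.exp (θ * Complex.I)) *
        conj (wienerEval g (Complex.exp (θ * Complex.I)))) := by
    intro θ
    have hz : ‖Complex.exp (θ * Complex.I)‖ ≤ 1 := (Complex.norm_exp_ofReal_mul_I θ).le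
    have hF : (fun p => F p θ) = fun p : ℕ × ℕ =>
        (coeff p.1 f * Complex.exp (θ * Complex.I) ^ p.1) *
          conj (coeff p.2 g * Complex.exp (θ * Complex.I) ^ p.2) := by
      funext p
      simp only [F]
      rw [exp_int_sub_mul_I, map_mul]
      ring
    rw [hF]
    exact hasSum_mul_conj (a := fun k => coeff k f * Complex.exp (θ * Complex.I) ^ k)
      (b := fun k => coeff k g * Complex.exp (θ * Complex.I) ^ k)
      (hf.summable_eval hz) (hg.summable_eval hz)
  have key := intervalIntegral.hasSum_integral_of_dominated_convergence
    (μ := volume) (a := 0) (b := 2 * Real.pi) (F := F)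
    (fun p _ => ‖coeff p.1 f‖ * ‖coeff p.2 g‖)
    (fun p => by
      apply Continuous.aestronglyMeasurable
      fun_prop)
    (fun p => Filter.Eventually.of_forall fun θ _ => (hFnorm p θ).le)
    (Filter.Eventually.of_forall fun θ _ => hprod)
    (by simp)
    (Filter.Eventually.of_forall fun θ _ => hFsum θ)
  rw [← key.tsum_eq]
  have hint : ∀ p : ℕ × ℕ, ∫ θ in (0 : ℝ)..2 * Real.pi, F p θ =
      if p.1 = p.2 then 2 * Real.pi * (coeff p.1 f * conj (coeff p.2 g)) else 0 := by
    intro p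
    simp only [F]
    rw [intervalIntegral.integral_const_mul, integral_exp_int_mul]
    by_cases h : p.1 = p.2
    · simp [h]; ring
    · have : ¬ ((p.1 : ℤ) - (p.2 : ℤ) = 0) := by omega
      simp [h, this]
  simp only [hint]
  rw [← tsum_mul_left]
  have hinj : Function.Injective (fun k : ℕ => (k, k)) := fun a b h => (Prod.mk.inj h).1
  rw [← hinj.tsum_eq]
  · simp
  · intro p hp
    by_cases h : p.1 = p.2
    · exact ⟨p.1, by ext <;> simp [h]⟩
    · simp [h] at hp

theorem Wiener.summable_sq {f : PowerSeries ℂ} (hf : Wiener f) :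
    Summable fun k => ‖coeff k f‖ ^ 2 := by
  have := Summable.mul_of_nonneg hf hf (fun _ => norm_nonneg _) (fun _ => norm_nonneg _)
  have h2 := this.comp_injective (i := fun k : ℕ => (k, k)) fun a b h => (Prod.mk.inj h).1
  simpa [Function.comp_def, ← sq] using h2

theorem Wiener.continuous_eval {f : PowerSeries ℂ} (hf : Wiener f) :
    Continuous fun θ : ℝ => wienerEval f (Complex.exp (θ * Complex.I)) := by
  refine continuous_tsum (fun k => by fun_prop) hf fun k θ => ?_
  rw [norm_mul, norm_pow, Complex.norm_exp_ofReal_mul_I, one_pow, mul_one]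

theorem integral_norm_wienerEval_sq {f : PowerSeries ℂ} (hf : Wiener f) :
    ∫ θ in (0 : ℝ)..2 * Real.pi, ‖wienerEval f (Complex.exp (θ * Complex.I))‖ ^ 2 =
      2 * Real.pi * ∑' k, ‖coeff k f‖ ^ 2 := by
  have h := integral_wienerEval_mul_conj hf hf
  simp only [Complex.mul_conj'] at h
  apply Complex.ofReal_injective
  push_cast
  rw [← h, ← intervalIntegral.integral_ofReal]
  push_cast
  rfl

/-- Multiplication by `f` is bounded on `ℓ²` by the supremum of `f` on the unit circle. -/
theorem tsum_norm_coeff_mul_sq_le {f u : PowerSeries ℂ} (hf : Wiener f) (hu : Wiener u) {M : ℝ}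
    (hM : ∀ z : ℂ, ‖z‖ = 1 → ‖wienerEval f z‖ ≤ M) :
    ∑' k, ‖coeff k (f * u)‖ ^ 2 ≤ M ^ 2 * ∑' k, ‖coeff k u‖ ^ 2 := by
  have h1 := integral_norm_wienerEval_sq (hf.mul hu)
  have h2 := integral_norm_wienerEval_sq hu
  have h3 : ∫ θ in (0 : ℝ)..2 * Real.pi,
        ‖wienerEval (f * u) (Complex.exp (θ * Complex.I))‖ ^ 2 ≤
      ∫ θ in (0 : ℝ)..2 * Real.pi, M ^ 2 * ‖wienerEval u (Complex.exp (θ * Complex.I))‖ ^ 2 := by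
    refine intervalIntegral.integral_mono_on (by positivity) ?_ ?_ fun θ _ => ?_
    · exact ((hf.mul hu).continuous_eval.norm.pow 2).intervalIntegrable _ _
    · exact ((hu.continuous_eval.norm.pow 2).const_mul _).intervalIntegrable _ _
    · have hz := Complex.norm_exp_ofReal_mul_I θ
      rw [wienerEval_mul hf hu hz.le, norm_mul, mul_pow]
      gcongr
      exact hM _ hz
  rw [h1, intervalIntegral.integral_const_mul, h2] at h3
  have hpi := Real.pi_pos
  nlinarith

theorem tsum_norm_coeff_sq_le {f : PowerSeries ℂ} (hf : Wiener f) {M : ℝ}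
    (hM : ∀ z : ℂ, ‖z‖ = 1 → ‖wienerEval f z‖ ≤ M) :
    ∑' k, ‖coeff k f‖ ^ 2 ≤ M ^ 2 := by
  have h := tsum_norm_coeff_mul_sq_le hf (u := 1) (by simpa using wiener_polynomial 1) hM
  have h1 : ∑' k, ‖coeff k (1 : PowerSeries ℂ)‖ ^ 2 = 1 := by
    rw [tsum_eq_single 0]
    · simp
    · intro k hk; simp [coeff_one, hk]
  rwa [h1, mul_one, mul_one] at h

end Wiener

/-! ### A Bernstein-type inequality for coefficients of rational functions -/

section Bernstein

open PowerSeries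

/-- The trace may be computed on the range, where each diagonal entry in an orthonormal basis is at
most `M`. -/
theorem norm_trace_le {E : Type*} [NormedAddCommGroup E] [InnerProductSpace ℂ E]
    [FiniteDimensional ℂ E] (X : E →ₗ[ℂ] E) {M : ℝ} (hM0 : 0 ≤ M) (hM : ∀ u, ‖X u‖ ≤ M * ‖u‖)
    {D : ℕ} (hD : Module.finrank ℂ (LinearMap.range X) ≤ D) :
    ‖LinearMap.trace ℂ E X‖ ≤ D * M := by
  have hmem : ∀ x, X x ∈ LinearMap.range X := fun x => LinearMap.mem_range_self X x
  rw [← LinearMap.trace_restrict_eq_of_forall_mem (LinearMap.range X) X hmem,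
    LinearMap.trace_eq_sum_inner _ (stdOrthonormalBasis ℂ (LinearMap.range X))]
  refine (norm_sum_le _ _).trans ?_
  have hterm : ∀ i, ‖inner ℂ (stdOrthonormalBasis ℂ (LinearMap.range X) i)
      ((X.restrict fun x _ => hmem x) (stdOrthonormalBasis ℂ (LinearMap.range X) i))‖ ≤ M := by
    intro i
    refine (norm_inner_le_norm _ _).trans ?_
    rw [OrthonormalBasis.norm_eq_one, one_mul, Submodule.coe_norm, LinearMap.coe_restrict_apply]
    refine (hM _).trans ?_
    rw [← Submodule.coe_norm, OrthonormalBasis.norm_eq_one, mul_one]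
  refine (Finset.sum_le_card_nsmul _ _ _ fun i _ => hterm i).trans ?_
  rw [Finset.card_univ, Fintype.card_fin, nsmul_eq_mul]
  gcongr

theorem coeff_sum_C_mul_X_pow {l : ℕ} (u : Fin l → ℂ) (k : ℕ) :
    coeff k (∑ j, C (u j) * X ^ (j : ℕ) : PowerSeries ℂ) = if h : k < l then u ⟨k, h⟩ else 0 := by
  simp only [map_sum, coeff_C_mul, coeff_X_pow, mul_ite, mul_one, mul_zero]
  split_ifs with h
  · rw [Finset.sum_eq_single ⟨k, h⟩]
    · simp
    · intro j _ hj
      rw [if_neg]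
      rintro rfl
      exact hj rfl
    · simp
  · refine Finset.sum_eq_zero fun j _ => if_neg ?_
    rintro rfl
    exact h j.2

theorem tsum_norm_coeff_sum_sq {l : ℕ} (u : Fin l → ℂ) :
    ∑' k, ‖coeff k (∑ j, C (u j) * X ^ (j : ℕ) : PowerSeries ℂ)‖ ^ 2 = ∑ j, ‖u j‖ ^ 2 := by
  simp only [coeff_sum_C_mul_X_pow]
  rw [tsum_eq_sum (s := Finset.range l), Finset.sum_range]
  · simp
  · intro k hk
    have : ¬ k < l := by simpa using hk
    simp [this]

theorem wiener_sum_C_mul_X_pow {l : ℕ} (u : Fin l → ℂ) :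
    Wiener (∑ j, C (u j) * X ^ (j : ℕ) : PowerSeries ℂ) := by
  refine summable_of_ne_finset_zero (s := Finset.range l) fun k hk => ?_
  have : ¬ k < l := by simpa using hk
  rw [coeff_sum_C_mul_X_pow, dif_neg this, norm_zero]

/-- If the coefficients of `f` satisfy, after index `D`, a linear recurrence of order `D`, then
`l * |f_l|` is at most `D` times the supremum of `|f|` on the unit circle. -/
theorem mul_norm_coeff_le_of_recurrence {f : PowerSeries ℂ} (hf : Wiener f) {M : ℝ}
    (hM : ∀ z : ℂ, ‖z‖ = 1 → ‖wienerEval f z‖ ≤ M) {D : ℕ} (q : ℕ → ℂ)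
    (hq : ∀ k, D < k → coeff k f = ∑ s ∈ Finset.range D, q s * coeff (k - 1 - s) f) (l : ℕ) :
    l * ‖coeff l f‖ ≤ D * M := by
  have hM0 : 0 ≤ M := (norm_nonneg _).trans (hM 1 (by simp))
  -- `Y` is the Toeplitz matrix with entries `f_(l+i-j)`. Its diagonal is constantly `f_l`, so its
  -- trace is `l * f_l`; its columns are windows `v t` of the coefficient sequence.
  let v : ℕ → EuclideanSpace ℂ (Fin l) := fun t => WithLp.toLp 2 fun i => coeff (t + 1 + i) f
  let Y : EuclideanSpace ℂ (Fin l) →ₗ[ℂ] EuclideanSpace ℂ (Fin l) :=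
    ∑ j : Fin l, (EuclideanSpace.projₗ j).smulRight (v (l - 1 - j))
  have hY : ∀ u, Y u = ∑ j : Fin l, u j • v (l - 1 - j) := by
    intro u
    simp [Y, LinearMap.sum_apply]
  have hYi : ∀ u i, Y u i = ∑ j : Fin l, u j * coeff (l + i - j) f := by
    intro u i
    rw [hY]
    simp only [WithLp.ofLp_sum, Finset.sum_apply, PiLp.smul_apply, smul_eq_mul, v]
    refine Finset.sum_congr rfl fun j _ => ?_
    have hj := j.2
    congr 3
    omega
  have hrange : Module.finrank ℂ (LinearMap.range Y) ≤ D := by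
    -- A window starts at index `t + 1`, so for `t ≥ D` all its indices exceed `D` and the
    -- recurrence applies to every entry.
    have hspan : ∀ t, v t ∈ Submodule.span ℂ (Set.range fun s : Fin D => v s) := by
      intro t
      induction t using Nat.strong_induction_on with
      | _ t ih =>
        by_cases ht : t < D
        · exact Submodule.subset_span ⟨⟨t, ht⟩, rfl⟩
        · have : v t = ∑ s ∈ Finset.range D, q s • v (t - 1 - s) := by
            ext i
            simp only [WithLp.ofLp_sum, Finset.sum_apply, PiLp.smul_apply, smul_eq_mul, v]
            rw [hq _ (by omega)]
            refine Finset.sum_congr rfl fun s hs => ?_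
            have := Finset.mem_range.1 hs
            congr 3
            omega
          rw [this]
          refine Submodule.sum_mem _ fun s hs => Submodule.smul_mem _ _ (ih _ ?_)
          have := Finset.mem_range.1 hs
          omega
    have hle : LinearMap.range Y ≤ Submodule.span ℂ (Set.range fun s : Fin D => v s) := by
      rintro _ ⟨u, rfl⟩
      rw [hY]
      exact Submodule.sum_mem _ fun j _ => Submodule.smul_mem _ _ (hspan _)
    refine (Submodule.finrank_mono hle).trans ?_
    exact (finrank_range_le_card (R := ℂ) fun s : Fin D => v s).trans (by simp)
  have hnorm : ∀ u, ‖Y u‖ ≤ M * ‖u‖ := by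
    intro u
    -- `Y u` is a block of consecutive coefficients of `f * U`, so `Y` inherits the `ℓ²` bound for
    -- multiplication by `f`.
    let U : PowerSeries ℂ := ∑ j, C (u j) * X ^ (j : ℕ)
    have hU : Wiener U := wiener_sum_C_mul_X_pow _
    have h1 := tsum_norm_coeff_mul_sq_le hf hU hM
    rw [tsum_norm_coeff_sum_sq, ← EuclideanSpace.norm_sq_eq, ← mul_pow] at h1
    have hs := (hf.mul hU).summable_sq
    have hcoeff : ∀ i : Fin l, Y u i = coeff (l + i) (f * U) := by
      intro i
      rw [hYi]
      simp only [U, Finset.mul_sum, map_sum]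
      refine Finset.sum_congr rfl fun j _ => ?_
      have hj := j.2
      rw [mul_left_comm, coeff_C_mul, coeff_mul_X_pow', if_pos (by omega)]
    have h2 : ‖Y u‖ ^ 2 ≤ ∑' k, ‖coeff k (f * U)‖ ^ 2 := by
      rw [EuclideanSpace.norm_sq_eq]
      simp only [hcoeff]
      have hinj : Function.Injective fun i : Fin l => l + (i : ℕ) :=
        fun a b h => Fin.ext (by simpa using h)
      rw [← tsum_fintype (L := .unconditional _)]
      exact tsum_comp_le_tsum_of_inj hs (fun _ => by positivity) hinj
    exact le_of_sq_le_sq (h2.trans h1) (by positivity)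
  have htrace : LinearMap.trace ℂ _ Y = l * coeff l f := by
    rw [LinearMap.trace_eq_sum_inner Y (EuclideanSpace.basisFun (Fin l) ℂ)]
    have : ∀ i : Fin l, inner ℂ (EuclideanSpace.basisFun (Fin l) ℂ i)
        (Y (EuclideanSpace.basisFun (Fin l) ℂ i)) = coeff l f := by
      intro i
      rw [EuclideanSpace.basisFun_apply, EuclideanSpace.inner_single_left, hYi,
        Finset.sum_eq_single i]
      · simp
      · intro j _ hj
        simp [hj]
      · simp
    rw [Finset.sum_congr rfl fun i _ => this i]
    simp
  have := norm_trace_le Y hM0 hnorm hrange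
  rwa [htrace, norm_mul, Complex.norm_natCast] at this

end Bernstein

/-! ### Finite Blaschke products and their Taylor coefficients -/

section Blaschke

open PowerSeries

/-- The finite Blaschke product with the given zeros. -/
def blaschkeProd (s : Multiset ℂ) (z : ℂ) : ℂ :=
  (s.map fun ν => (z - ν) / (1 - conj ν * z)).prod

/-- The Taylor series at `0` of the finite Blaschke product with the given zeros. -/
def blaschkeSeries (s : Multiset ℂ) : PowerSeries ℂ :=
  (s.map fun ν => (X - C ν) * mk fun k => (conj ν) ^ k).prod

theorem blaschkeProd_cons (a : ℂ) (s : Multiset ℂ) (z : ℂ) :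
    blaschkeProd (a ::ₘ s) z = (z - a) / (1 - conj a * z) * blaschkeProd s z := by
  simp [blaschkeProd]

theorem blaschkeSeries_cons (a : ℂ) (s : Multiset ℂ) :
    blaschkeSeries (a ::ₘ s) = ((X - C a) * mk fun k => (conj a) ^ k) * blaschkeSeries s := by
  simp [blaschkeSeries]

theorem rescale_X_sub_C (R a : ℂ) :
    rescale R (X - C a) = ((Polynomial.C R * Polynomial.X - Polynomial.C a : Polynomial ℂ) :
      PowerSeries ℂ) := by
  rw [map_sub, rescale_X]
  simp only [Polynomial.coe_sub, Polynomial.coe_mul, Polynomial.coe_C, Polynomial.coe_X]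
  congr 1
  ext n
  simp only [coeff_rescale, coeff_C]
  split_ifs with h <;> simp [h]

theorem rescale_mk_pow (R a : ℂ) :
    rescale R (mk fun k => a ^ k) = mk fun k => (R * a) ^ k := by
  ext n
  simp [coeff_rescale, mul_pow]

/-- Rescaling carries the circle of radius `R` to the unit circle, so the Parseval estimates apply
on any circle inside the poles. -/
theorem wiener_rescale_blaschkeSeries {s : Multiset ℂ} {R : ℝ} (hR : 0 ≤ R)
    (hs : ∀ a ∈ s, ‖a‖ * R < 1) :
    Wiener (rescale (R : ℂ) (blaschkeSeries s)) ∧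
      ∀ z : ℂ, ‖z‖ ≤ 1 → wienerEval (rescale (R : ℂ) (blaschkeSeries s)) z =
        blaschkeProd s (R * z) := by
  induction s using Multiset.induction_on with
  | empty =>
    have h1 : rescale (R : ℂ) (blaschkeSeries 0) = ((1 : Polynomial ℂ) : PowerSeries ℂ) := by
      simp [blaschkeSeries]
    rw [h1]
    exact ⟨wiener_polynomial _, fun z _ => by rw [wienerEval_polynomial]; simp [blaschkeProd]⟩
  | cons a s ih =>
    obtain ⟨ih1, ih2⟩ := ih fun b hb => hs b (Multiset.mem_cons_of_mem hb)
    have ha := hs a (Multiset.mem_cons_self a s)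
    have ha' : ‖(R : ℂ) * conj a‖ < 1 := by
      rw [norm_mul, RCLike.norm_conj, Complex.norm_real, Real.norm_of_nonneg hR, mul_comm]
      exact ha
    rw [blaschkeSeries_cons, map_mul, map_mul, rescale_X_sub_C, rescale_mk_pow]
    have h1 := wiener_polynomial (Polynomial.C (R : ℂ) * Polynomial.X - Polynomial.C a)
    have h2 := wiener_mk_pow ha'
    refine ⟨(h1.mul h2).mul ih1, fun z hz => ?_⟩
    rw [wienerEval_mul (h1.mul h2) ih1 hz, wienerEval_mul h1 h2 hz, ih2 z hz,
      wienerEval_polynomial, wienerEval_mk_pow ha' hz, blaschkeProd_cons]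
    simp only [Polynomial.eval_sub, Polynomial.eval_mul, Polynomial.eval_C, Polynomial.eval_X]
    rw [div_eq_mul_inv, mul_assoc (R : ℂ), mul_left_comm (R : ℂ)]

theorem wiener_blaschkeSeries {s : Multiset ℂ} (hs : ∀ a ∈ s, ‖a‖ < 1) :
    Wiener (blaschkeSeries s) ∧
      ∀ z : ℂ, ‖z‖ ≤ 1 → wienerEval (blaschkeSeries s) z = blaschkeProd s z := by
  have h := wiener_rescale_blaschkeSeries (R := 1) zero_le_one (by simpa using hs)
  simpa using h

theorem blaschkeSeries_eq (s : Multiset ℂ) :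
    blaschkeSeries s = ((s.map fun a => (Polynomial.X - Polynomial.C a)).prod : Polynomial ℂ) *
      (s.map fun a => (mk fun k => (conj a) ^ k : PowerSeries ℂ)).prod := by
  induction s using Multiset.induction_on with
  | empty => simp [blaschkeSeries]
  | cons a s ih =>
    rw [blaschkeSeries_cons, ih]
    simp only [Multiset.map_cons, Multiset.prod_cons, Polynomial.coe_mul, Polynomial.coe_sub,
      Polynomial.coe_X, Polynomial.coe_C]
    ring

theorem wiener_prod_mk_pow {s : Multiset ℂ} (hs : ∀ a ∈ s, ‖a‖ < 1) :
    Wiener (s.map fun a => (mk fun k => (conj a) ^ k : PowerSeries ℂ)).prod := by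
  induction s using Multiset.induction_on with
  | empty => simpa using wiener_polynomial 1
  | cons a s ih =>
    rw [Multiset.map_cons, Multiset.prod_cons]
    refine (wiener_mk_pow ?_).mul (ih fun b hb => hs b (Multiset.mem_cons_of_mem hb))
    rw [RCLike.norm_conj]
    exact hs a (Multiset.mem_cons_self a s)

theorem exists_denominator (s : Multiset ℂ) :
    ∃ Q : Polynomial ℂ, Q.natDegree ≤ s.card ∧ Q.coeff 0 = 1 ∧
      (s.map fun a => (mk fun k => (conj a) ^ k : PowerSeries ℂ)).prod * Q = 1 := by
  induction s using Multiset.induction_on with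
  | empty => exact ⟨1, by simp⟩
  | cons a s ih =>
    obtain ⟨Q, h1, h2, h3⟩ := ih
    refine ⟨(1 - Polynomial.C (conj a) * Polynomial.X) * Q, ?_, ?_, ?_⟩
    · refine Polynomial.natDegree_mul_le.trans ?_
      rw [Multiset.card_cons, add_comm]
      refine add_le_add h1 ?_
      compute_degree
    · simp [Polynomial.mul_coeff_zero, h2]
    · have hgeom : (mk fun k => (conj a) ^ k : PowerSeries ℂ) * (1 - C (conj a) * X) = 1 := by
        have h := congrArg (rescale (conj a)) (mk_one_mul_one_sub_eq_one ℂ)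
        rw [map_mul, map_sub, map_one, rescale_X] at h
        have h' : rescale (conj a) (mk 1) = mk fun k => (conj a) ^ k := by
          ext n
          simp [coeff_rescale]
        rwa [h'] at h
      rw [Multiset.map_cons, Multiset.prod_cons, Polynomial.coe_mul, Polynomial.coe_sub,
        Polynomial.coe_one, Polynomial.coe_mul, Polynomial.coe_C, Polynomial.coe_X]
      calc _ = ((mk fun k => (conj a) ^ k : PowerSeries ℂ) * (1 - C (conj a) * X)) *
            ((s.map fun a => (mk fun k => (conj a) ^ k : PowerSeries ℂ)).prod *
              (Q : PowerSeries ℂ)) := by ring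
        _ = 1 := by rw [hgeom, h3, one_mul]

/-- Clearing the denominator gives `Q * b = P` with `P` of degree `s.card`. Coefficients beyond that
degree vanish, and `Q.coeff 0 = 1` allows solving for the last one. -/
theorem exists_recurrence_blaschkeSeries (s : Multiset ℂ) :
    ∃ q : ℕ → ℂ, ∀ k, s.card < k → coeff k (blaschkeSeries s) =
      ∑ i ∈ Finset.range s.card, q i * coeff (k - 1 - i) (blaschkeSeries s) := by
  obtain ⟨Q, h1, h2, h3⟩ := exists_denominator s
  refine ⟨fun i => - Q.coeff (i + 1), fun k hk => ?_⟩
  set P : Polynomial ℂ := (s.map fun a => (Polynomial.X - Polynomial.C a)).prod with hP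
  have hPdeg : P.natDegree = s.card := by
    rw [hP, Polynomial.natDegree_multiset_prod_X_sub_C_eq_card]
  have hbQ : (Q : PowerSeries ℂ) * blaschkeSeries s = P := by
    rw [blaschkeSeries_eq, ← hP, mul_left_comm, mul_comm (Q : PowerSeries ℂ), h3, mul_one]
  have hk0 := congrArg (coeff k) hbQ
  rw [Polynomial.coeff_coe, Polynomial.coeff_eq_zero_of_natDegree_lt (by omega), coeff_mul,
    Finset.Nat.sum_antidiagonal_eq_sum_range_succ
      (fun i j => coeff i (Q : PowerSeries ℂ) * coeff j (blaschkeSeries s)),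
    Finset.sum_range_succ', Polynomial.coeff_coe, h2, one_mul, Nat.sub_zero] at hk0
  have hsum : ∑ i ∈ Finset.range k, coeff (i + 1) (Q : PowerSeries ℂ) *
      coeff (k - (i + 1)) (blaschkeSeries s) = ∑ i ∈ Finset.range s.card, Q.coeff (i + 1) *
      coeff (k - 1 - i) (blaschkeSeries s) := by
    rw [← Finset.sum_subset (Finset.range_subset_range.2 hk.le)]
    · refine Finset.sum_congr rfl fun i _ => ?_
      rw [Polynomial.coeff_coe, Nat.sub_sub, Nat.add_comm 1 i]
    · intro i _ hi
      rw [Polynomial.coeff_coe, Polynomial.coeff_eq_zero_of_natDegree_lt, zero_mul]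
      have : ¬ i < s.card := by simpa using hi
      omega
  rw [hsum] at hk0
  simp only [neg_mul, Finset.sum_neg_distrib]
  exact eq_neg_of_add_eq_zero_right hk0

theorem norm_blaschkeProd_of_norm_eq_one {s : Multiset ℂ} (hs : ∀ a ∈ s, ‖a‖ < 1) {z : ℂ}
    (hz : ‖z‖ = 1) : ‖blaschkeProd s z‖ = 1 := by
  induction s using Multiset.induction_on with
  | empty => simp [blaschkeProd]
  | cons a s ih =>
    have ha := hs a (Multiset.mem_cons_self a s)
    rw [blaschkeProd_cons, norm_mul, ih fun b hb => hs b (Multiset.mem_cons_of_mem hb), mul_one,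
      norm_div]
    have h1 : 1 - conj a * z = z * conj (z - a) := by
      rw [map_sub, mul_sub, Complex.mul_conj', hz]
      push_cast
      ring
    have h2 : z - a ≠ 0 := by
      intro h
      rw [← sub_eq_zero.1 h] at ha
      linarith
    rw [h1, norm_mul, hz, one_mul, RCLike.norm_conj, div_self (norm_ne_zero_iff.2 h2)]

/-- Reflection in the unit circle, factor by factor. Zeros and poles need no exclusion: division by
zero makes both sides `0` there. -/
theorem blaschkeProd_inv_conj (s : Multiset ℂ) {z : ℂ} (hz : z ≠ 0) :
    blaschkeProd s (conj z)⁻¹ = conj (blaschkeProd s z)⁻¹ := by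
  induction s using Multiset.induction_on with
  | empty => simp [blaschkeProd]
  | cons a s ih =>
    have hz' : conj z ≠ 0 := by simpa using hz
    rw [blaschkeProd_cons, blaschkeProd_cons, ih, mul_inv, map_mul, inv_div, map_div₀,
      ← mul_div_mul_left _ _ hz', mul_sub, mul_sub, mul_inv_cancel₀ hz', mul_left_comm,
      mul_inv_cancel₀ hz']
    simp [mul_comm]

/-- On `|z| = R` the quotient is largest when the denominator is smallest, with value `(R - |a|) /
(1 - |a| * R) = 1 + (R - 1) * (1 + |a|) / (1 - |a| * R)`; `hRδ` says that this is at most `1 + δ`.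
-/
theorem norm_sub_div_le {a z : ℂ} {R δ : ℝ} (hz : ‖z‖ = R) (hR : 1 ≤ R) (haR : ‖a‖ * R < 1)
    (hδ : 0 ≤ δ) (hRδ : (R - 1) * (1 + ‖a‖) ≤ δ * (1 - ‖a‖ * R)) :
    ‖(z - a) / (1 - conj a * z)‖ ≤ 1 + δ := by
  have ha0 := norm_nonneg a
  have hlow : 1 - ‖a‖ * R ≤ ‖1 - conj a * z‖ := by
    have := norm_sub_norm_le 1 (conj a * z)
    rwa [norm_one, norm_mul, RCLike.norm_conj, hz] at this
  have hpos : 0 < ‖1 - conj a * z‖ := lt_of_lt_of_le (by linarith) hlow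
  have hid : ‖z - a‖ ^ 2 = ‖1 - conj a * z‖ ^ 2 + (R ^ 2 - 1) * (1 - ‖a‖ ^ 2) := by
    rw [← hz]
    simp only [← Complex.normSq_eq_norm_sq, Complex.normSq_apply]
    simp
    ring
  rw [norm_div, div_le_iff₀ hpos]
  refine le_of_sq_le_sq ?_ (by positivity)
  rw [hid, mul_pow]
  set t := ‖a‖
  set y := ‖1 - conj a * z‖
  have h0 : 0 < 1 - t * R := by linarith
  have h1 : t < 1 := by nlinarith
  have h2 : (R - 1) * (1 + t) ≤ δ * y := hRδ.trans (by gcongr)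
  have h3 : (R + 1) * (1 - t) ≤ 2 * y + δ * y := by
    have : (R + 1) * (1 - t) = 2 * (1 - t * R) + (R - 1) * (1 + t) := by ring
    linarith
  have h4 : ((R - 1) * (1 + t)) * ((R + 1) * (1 - t)) ≤ (δ * y) * (2 * y + δ * y) :=
    mul_le_mul h2 h3 (mul_nonneg (by linarith) (by linarith)) (by positivity)
  nlinarith

theorem norm_blaschkeProd_le_pow {s : Multiset ℂ} {z : ℂ} {R δ : ℝ} (hz : ‖z‖ = R) (hR : 1 ≤ R)
    (hs : ∀ a ∈ s, ‖a‖ * R < 1) (hδ : 0 ≤ δ)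
    (hRδ : ∀ a ∈ s, (R - 1) * (1 + ‖a‖) ≤ δ * (1 - ‖a‖ * R)) :
    ‖blaschkeProd s z‖ ≤ (1 + δ) ^ s.card := by
  induction s using Multiset.induction_on with
  | empty => simp [blaschkeProd]
  | cons a s ih =>
    rw [blaschkeProd_cons, norm_mul, Multiset.card_cons, pow_succ']
    have ha := Multiset.mem_cons_self a s
    exact mul_le_mul (norm_sub_div_le hz hR (hs a ha) hδ (hRδ a ha))
      (ih (fun b hb => hs b (Multiset.mem_cons_of_mem hb))
        fun b hb => hRδ b (Multiset.mem_cons_of_mem hb)) (norm_nonneg _) (by positivity)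

end Blaschke

/-! ### Bounded sequences satisfying a linear recurrence -/

section Recurrence

open PowerSeries

/-- The shifts of a finite Blaschke product are orthonormal on the unit circle. -/
theorem sum_coeff_blaschkeSeries_mul_conj {s : Multiset ℂ} (hs : ∀ a ∈ s, ‖a‖ < 1) (n j : ℕ) :
    (if j = n then 1 else 0 : ℂ) =
      ∑ i ∈ Finset.range (n + 1), coeff j (X ^ i * blaschkeSeries s) *
        conj (coeff (n - i) (blaschkeSeries s)) +
      ∑' k, coeff (j + k + 1) (blaschkeSeries s) *
        conj (coeff (n + k + 1) (blaschkeSeries s)) := by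
  obtain ⟨hb, hev⟩ := wiener_blaschkeSeries hs
  set b := blaschkeSeries s
  have hX : ∀ m : ℕ, Wiener (X ^ m : PowerSeries ℂ) := fun m => by
    simpa using wiener_polynomial (Polynomial.X ^ m)
  have h1 := integral_wienerEval_mul_conj ((hX n).mul hb) ((hX j).mul hb)
  have h2 := integral_wienerEval_mul_conj (hX n) (hX j)
  -- Since `|b| = 1` on the circle, the inner product of two shifts of `b` is that of the
  -- corresponding monomials.
  have heq : ∀ θ : ℝ, wienerEval (X ^ n * b) (Complex.exp (θ * Complex.I)) *
        conj (wienerEval (X ^ j * b) (Complex.exp (θ * Complex.I))) =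
      wienerEval (X ^ n) (Complex.exp (θ * Complex.I)) *
        conj (wienerEval (X ^ j) (Complex.exp (θ * Complex.I))) := by
    intro θ
    have hz := Complex.norm_exp_ofReal_mul_I θ
    rw [wienerEval_mul (hX n) hb hz.le, wienerEval_mul (hX j) hb hz.le, hev _ hz.le, map_mul,
      mul_mul_mul_comm, Complex.mul_conj' (blaschkeProd s _),
      norm_blaschkeProd_of_norm_eq_one hs hz]
    simp
  simp only [heq] at h1
  rw [h1] at h2
  have hpi : (2 * Real.pi : ℂ) ≠ 0 := by
    exact_mod_cast Real.two_pi_pos.ne'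
  have h3 := mul_left_cancel₀ hpi h2
  have h4 : ∑' k, coeff k (X ^ n : PowerSeries ℂ) * conj (coeff k (X ^ j : PowerSeries ℂ)) =
      if j = n then 1 else 0 := by
    rw [tsum_eq_single n]
    · simp [coeff_X_pow, eq_comm]
    · intro k hk
      simp [coeff_X_pow, hk]
  rw [h4] at h3
  have hsum : Summable fun k => coeff k (X ^ n * b) * conj (coeff k (X ^ j * b)) := by
    have hn := ((hX n).mul hb)
    have hj := ((hX j).mul hb)
    have := Summable.mul_of_nonneg hn hj (fun _ => norm_nonneg _) (fun _ => norm_nonneg _)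
    have h2 := this.comp_injective (i := fun k : ℕ => (k, k)) fun a b h => (Prod.mk.inj h).1
    refine Summable.of_norm ?_
    simpa [Function.comp_def] using h2
  -- The Parseval sum is cut at `k = n + j + 1`. Below the cut, `k = n + j - i` produces the factors
  -- `b_(j-i)` and `b_(n-i)`, and the terms with `i > n` vanish.
  rw [← h3, ← hsum.sum_add_tsum_nat_add (n + j + 1)]
  congr 1
  · rw [← Finset.sum_range_reflect, ← Finset.sum_subset
      (Finset.range_subset_range.2 (show n + 1 ≤ n + j + 1 by omega))]
    · refine Finset.sum_congr rfl fun i hi => ?_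
      have hi' := Finset.mem_range.1 hi
      rw [coeff_X_pow_mul', coeff_X_pow_mul', coeff_X_pow_mul',
        if_pos (show j ≤ n + j + 1 - 1 - i by omega),
        show n + j + 1 - 1 - i - j = n - i by omega]
      by_cases hij : i ≤ j
      · rw [if_pos hij, if_pos (by omega), show n + j + 1 - 1 - i - n = j - i by omega]
      · rw [if_neg hij, if_neg (by omega)]
    · intro i hi hi'
      have h5 := Finset.mem_range.1 hi
      have h6 : ¬ i < n + 1 := by simpa using hi'
      rw [coeff_X_pow_mul' _ j, if_neg (by omega), map_zero, mul_zero]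
  · refine tsum_congr fun k => ?_
    rw [coeff_X_pow_mul', coeff_X_pow_mul', if_pos (by omega), if_pos (by omega)]
    congr 3
    · omega
    · congr 1; omega

theorem Wiener.summable_mul_bounded {f : PowerSeries ℂ} (hf : Wiener f) {x : ℕ → ℂ} {K : ℝ}
    (hx : ∀ k, ‖x k‖ ≤ K) (t : ℕ) : Summable fun k => coeff k f * x (k + t) := by
  refine Summable.of_norm_bounded (hf.mul_right K) fun k => ?_
  rw [norm_mul]
  exact mul_le_mul_of_nonneg_left (hx _) (norm_nonneg _)

theorem tsum_coeff_mul_shift {f g : PowerSeries ℂ} (hf : Wiener f) (hg : Wiener g) {x : ℕ → ℂ}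
    {K : ℝ} (hx : ∀ k, ‖x k‖ ≤ K) (t : ℕ) :
    ∑' k, coeff k (g * f) * x (k + t) =
      ∑' j, coeff j g * ∑' i, coeff i f * x (i + (j + t)) := by
  let F : ℕ × ℕ → ℂ := fun p => coeff p.1 g * coeff p.2 f * x (p.1 + p.2 + t)
  have hF : Summable F := by
    have := (Summable.mul_of_nonneg hg hf (fun _ => norm_nonneg _)
      (fun _ => norm_nonneg _)).mul_right K
    refine Summable.of_norm_bounded this fun p => ?_
    simp only [F, norm_mul]
    exact mul_le_mul_of_nonneg_left (hx _) (by positivity)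
  have h1 : ∑' p, F p = ∑' j, coeff j g * ∑' i, coeff i f * x (i + (j + t)) := by
    rw [hF.tsum_prod]
    refine tsum_congr fun j => ?_
    rw [← tsum_mul_left]
    refine tsum_congr fun i => ?_
    simp only [F]
    rw [mul_assoc, show j + i + t = i + (j + t) by ring]
  have hF' : Summable fun c => F (Finset.HasAntidiagonal.sigmaAntidiagonalEquivProd c) :=
    Finset.HasAntidiagonal.sigmaAntidiagonalEquivProd.summable_iff.2 hF
  rw [← h1, ← Finset.HasAntidiagonal.sigmaAntidiagonalEquivProd.tsum_eq F, hF'.tsum_sigma]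
  refine tsum_congr fun k => ?_
  rw [tsum_fintype, coeff_mul, Finset.sum_mul]
  refine Eq.trans ?_
    (Finset.sum_coe_sort (Finset.HasAntidiagonal.antidiagonal k) fun p : ℕ × ℕ => F p).symm
  refine Finset.sum_congr rfl fun p hp => ?_
  simp only [F]
  rw [Finset.HasAntidiagonal.mem_antidiagonal.1 hp]

/-- The numerator of `b` alone annihilates every shift of `x`; absolute summability and boundedness
of `x` allow it to be applied first and the denominator series afterwards. -/
theorem tsum_coeff_blaschkeSeries_mul_eq_zero {s : Multiset ℂ} (hs : ∀ a ∈ s, ‖a‖ < 1)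
    {x : ℕ → ℂ} {K : ℝ} (hx : ∀ k, ‖x k‖ ≤ K)
    (hrec : ∀ t, ∑ i ∈ Finset.range (s.card + 1),
      ((s.map fun a => (Polynomial.X - Polynomial.C a)).prod).coeff i * x (i + t) = 0) (t : ℕ) :
    ∑' k, coeff k (blaschkeSeries s) * x (k + t) = 0 := by
  rw [blaschkeSeries_eq, mul_comm,
    tsum_coeff_mul_shift (wiener_polynomial _) (wiener_prod_mk_pow hs) hx]
  refine (tsum_congr fun j => ?_).trans tsum_zero
  rw [tsum_eq_sum (s := Finset.range (s.card + 1))]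
  · simp only [Polynomial.coeff_coe]
    rw [hrec, mul_zero]
  · intro k hk
    rw [Polynomial.coeff_coe, Polynomial.coeff_eq_zero_of_natDegree_lt, zero_mul]
    rw [Polynomial.natDegree_multiset_prod_X_sub_C_eq_card]
    simpa [Nat.lt_succ_iff] using hk

/-- Summing the orthonormality relation against `x_j` isolates `x_n`. The finitely many shifts `X ^
i * b` contribute nothing in the limit, because `b` annihilates `x`; only the tail products remain.
-/
theorem norm_le_tsum_mul_tsum {s : Multiset ℂ} (hs : ∀ a ∈ s, ‖a‖ < 1)
    {x : ℕ → ℂ} {K : ℝ} (hx : ∀ k, ‖x k‖ ≤ K)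
    (hrec : ∀ t, ∑ i ∈ Finset.range (s.card + 1),
      ((s.map fun a => (Polynomial.X - Polynomial.C a)).prod).coeff i * x (i + t) = 0) (n : ℕ) :
    ‖x n‖ ≤ K * ((∑' k, ‖coeff (n + k + 1) (blaschkeSeries s)‖) *
      ∑' k, ‖coeff (k + 1) (blaschkeSeries s)‖) := by
  have hK : 0 ≤ K := (norm_nonneg _).trans (hx 0)
  obtain ⟨hb, -⟩ := wiener_blaschkeSeries hs
  have hzero := tsum_coeff_blaschkeSeries_mul_eq_zero hs hx hrec
  have horth := sum_coeff_blaschkeSeries_mul_conj hs n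
  set b := blaschkeSeries s
  have hX : ∀ m : ℕ, Wiener (X ^ m : PowerSeries ℂ) := fun m => by
    simpa using wiener_polynomial (Polynomial.X ^ m)
  have hshift : ∀ m : ℕ, Summable fun k => ‖coeff (k + m) b‖ := fun m =>
    (summable_nat_add_iff m).2 hb
  set S := ∑' k, ‖coeff (k + 1) b‖
  have hn1 : Summable fun k => ‖coeff (n + k + 1) b‖ := by
    simpa [add_assoc, add_comm, add_left_comm] using hshift (n + 1)
  have hbb : ∀ j, Summable fun k => ‖coeff (j + k + 1) b‖ * ‖coeff (n + k + 1) b‖ := by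
    intro j
    refine Summable.of_nonneg_of_le (fun _ => by positivity) (fun k => ?_)
      (hn1.mul_left (∑' k, ‖coeff k b‖))
    gcongr
    exact hb.le_tsum (j + k + 1) fun _ _ => norm_nonneg _
  -- Truncating at `j < J` recovers `x n` exactly once `J > n`; the shift part tends to `0` while
  -- the tail part is bounded uniformly in `J`.
  have htend : Filter.Tendsto (fun J => ∑ j ∈ Finset.range J, (∑ i ∈ Finset.range (n + 1),
      coeff j (X ^ i * b) * conj (coeff (n - i) b)) * x j) Filter.atTop (nhds 0) := by
    have h1 : ∀ J, ∑ j ∈ Finset.range J, (∑ i ∈ Finset.range (n + 1),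
        coeff j (X ^ i * b) * conj (coeff (n - i) b)) * x j =
        ∑ i ∈ Finset.range (n + 1), conj (coeff (n - i) b) *
          ∑ j ∈ Finset.range J, coeff j (X ^ i * b) * x j := by
      intro J
      simp only [Finset.sum_mul, Finset.mul_sum]
      rw [Finset.sum_comm]
      refine Finset.sum_congr rfl fun i _ => Finset.sum_congr rfl fun j _ => by ring
    simp only [h1]
    rw [show (0 : ℂ) = ∑ i ∈ Finset.range (n + 1), conj (coeff (n - i) b) * 0 by simp]
    refine tendsto_finsetSum _ fun i _ => Filter.Tendsto.const_mul _ ?_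
    have h2 := ((hX i).mul hb).summable_mul_bounded hx 0
    have h3 := h2.hasSum.tendsto_sum_nat
    rw [tsum_coeff_mul_shift hb (hX i) hx 0] at h3
    simpa [hzero] using h3
  have hbound : ∀ J, ‖∑ j ∈ Finset.range J, (∑' k, coeff (j + k + 1) b *
      conj (coeff (n + k + 1) b)) * x j‖ ≤ K * ((∑' k, ‖coeff (n + k + 1) b‖) * S) := by
    intro J
    calc _ ≤ ∑ j ∈ Finset.range J, (∑' k, ‖coeff (j + k + 1) b‖ * ‖coeff (n + k + 1) b‖) * K := by
          refine (norm_sum_le _ _).trans (Finset.sum_le_sum fun j _ => ?_)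
          rw [norm_mul]
          refine mul_le_mul ?_ (hx j) (norm_nonneg _) (tsum_nonneg fun _ => by positivity)
          refine (norm_tsum_le_tsum_norm ?_).trans (le_of_eq ?_)
          · simpa using hbb j
          · simp
      _ = K * ∑' k, ∑ j ∈ Finset.range J, ‖coeff (j + k + 1) b‖ * ‖coeff (n + k + 1) b‖ := by
          rw [← Finset.sum_mul, Summable.tsum_finsetSum fun j _ => hbb j, mul_comm]
      _ ≤ K * ((∑' k, ‖coeff (n + k + 1) b‖) * S) := by
          gcongr
          rw [← tsum_mul_right]
          refine Summable.tsum_le_tsum (fun k => ?_) (summable_sum fun j _ => hbb j)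
            (hn1.mul_right S)
          rw [← Finset.sum_mul, mul_comm]
          gcongr
          have h1 : ∑ j ∈ Finset.range J, ‖coeff (j + k + 1) b‖ ≤
              ∑' j, ‖coeff (j + (k + 1)) b‖ :=
            (hshift (k + 1)).sum_le_tsum _ fun _ _ => norm_nonneg _
          refine h1.trans ?_
          have h2 := tsum_comp_le_tsum_of_inj (hshift 1) (fun _ => norm_nonneg _)
            (i := fun j : ℕ => j + k) (add_left_injective k)
          exact h2
  have hx' : ∀ J, n < J → x n = ∑ j ∈ Finset.range J, (∑ i ∈ Finset.range (n + 1),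
      coeff j (X ^ i * b) * conj (coeff (n - i) b)) * x j + ∑ j ∈ Finset.range J,
      (∑' k, coeff (j + k + 1) b * conj (coeff (n + k + 1) b)) * x j := by
    intro J hJ
    rw [← Finset.sum_add_distrib]
    simp only [← add_mul, ← horth]
    simp [hJ]
  have hlim : Filter.Tendsto (fun J => ‖∑ j ∈ Finset.range J, (∑ i ∈ Finset.range (n + 1),
      coeff j (X ^ i * b) * conj (coeff (n - i) b)) * x j‖ +
      K * ((∑' k, ‖coeff (n + k + 1) b‖) * S)) Filter.atTop
      (nhds (0 + K * ((∑' k, ‖coeff (n + k + 1) b‖) * S))) := by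
    refine Filter.Tendsto.add_const _ ?_
    simpa using htend.norm
  rw [zero_add] at hlim
  refine ge_of_tendsto hlim ?_
  filter_upwards [Filter.eventually_gt_atTop n] with J hJ
  conv_lhs => rw [hx' J hJ]
  exact (norm_add_le _ _).trans (add_le_add_right (hbound J) _)

end Recurrence

/-! ### The bound on bounded recurrent sequences -/

section Bound

open PowerSeries

theorem sum_norm_coeff_blaschkeSeries_le {s : Multiset ℂ} {μ : ℝ} (hμ0 : 0 ≤ μ) (hμ1 : μ < 1)
    (hs : ∀ a ∈ s, ‖a‖ ≤ μ) (hcard : 0 < s.card) :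
    ∑' k, ‖coeff (k + 1) (blaschkeSeries s)‖ ≤
      2 * Real.exp 1 * (√(s.card : ℝ) / √(1 - μ)) := by
  set D : ℝ := (s.card : ℝ) with hDdef
  have hD : 1 ≤ D := by rw [hDdef]; exact_mod_cast hcard
  -- With this radius each Blaschke factor is at most `1 + 1 / D` on `|z| = R`, so the product of
  -- `D` factors is at most `e`.
  set R : ℝ := 1 + (1 - μ) / (3 * D) with hRdef
  have hq : 0 < (1 - μ) / (3 * D) := div_pos (by linarith) (by linarith)
  have hR1 : 1 < R := by linarith
  have hqD : (1 - μ) / (3 * D) * (3 * D) = 1 - μ := div_mul_cancel₀ _ (by positivity)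
  have hq3 : (1 - μ) / (3 * D) ≤ (1 - μ) / 3 :=
    div_le_div_of_nonneg_left (by linarith) (by norm_num) (by linarith)
  have key : ∀ a ∈ s, 2 / 3 * (1 - ‖a‖) ≤ 1 - ‖a‖ * R := by
    intro a ha
    have h1 := hs a ha
    have h0 := norm_nonneg a
    rw [hRdef]
    nlinarith
  have hsR : ∀ a ∈ s, ‖a‖ * R < 1 := by
    intro a ha
    have h1 := hs a ha
    have := key a ha
    linarith
  obtain ⟨hc, hev⟩ := wiener_rescale_blaschkeSeries (by linarith : (0 : ℝ) ≤ R) hsR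
  have hsup : ∀ z : ℂ, ‖z‖ = 1 →
      ‖wienerEval (rescale (R : ℂ) (blaschkeSeries s)) z‖ ≤ Real.exp 1 := by
    intro z hz
    rw [hev z hz.le]
    have hRz : ‖(R : ℂ) * z‖ = R := by
      rw [norm_mul, hz, mul_one, Complex.norm_real, Real.norm_of_nonneg (by linarith)]
    refine (norm_blaschkeProd_le_pow (δ := 1 / D) hRz hR1.le hsR (by positivity) ?_).trans ?_
    · intro a ha
      have h1 := hs a ha
      have h0 := norm_nonneg a
      have h2 := key a ha
      have h3 : R - 1 = (1 - μ) / 3 * (1 / D) := by rw [hRdef]; field_simp; ring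
      rw [h3]
      have h4 : (1 - μ) / 3 * (1 + ‖a‖) ≤ 1 - ‖a‖ * R := by nlinarith
      have h5 : 0 ≤ 1 / D := by positivity
      nlinarith
    · have h1 : 1 + 1 / D ≤ Real.exp (1 / D) := by
        have := Real.add_one_le_exp (1 / D)
        linarith
      calc (1 + 1 / D) ^ s.card ≤ Real.exp (1 / D) ^ s.card := by gcongr
        _ = Real.exp 1 := by
          rw [← Real.exp_nat_mul]
          congr 1
          exact mul_one_div_cancel (by positivity)
  have hsq := tsum_norm_coeff_sq_le hc hsup
  have hcs := hc.summable_sq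
  have hcoeff : ∀ k, ‖coeff k (rescale (R : ℂ) (blaschkeSeries s))‖ =
      R ^ k * ‖coeff k (blaschkeSeries s)‖ := by
    intro k
    rw [coeff_rescale, norm_mul, norm_pow, Complex.norm_real, Real.norm_of_nonneg (by linarith)]
  set b := blaschkeSeries s
  have hRinv : (R⁻¹) ^ 2 < 1 := by
    rw [inv_pow]
    exact inv_lt_one_of_one_lt₀ (by nlinarith)
  -- The full geometric sum is `1 / (R ^ 2 - 1) ≤ 1 / (2 * (R - 1))`. The factor `3 / 2` is below `2
  -- ^ 2`, which explains the constant `2` after the square root.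
  have hgeom : ∀ J, ∑ k ∈ Finset.range J, ((R⁻¹) ^ (k + 1)) ^ 2 ≤ 3 / 2 * (D / (1 - μ)) := by
    intro J
    have h1 : ∀ k, ((R⁻¹) ^ (k + 1)) ^ 2 = (R⁻¹) ^ 2 * ((R⁻¹) ^ 2) ^ k := by intro k; ring
    simp only [h1]
    have h2 := (summable_geometric_of_lt_one (by positivity) hRinv).mul_left ((R⁻¹) ^ 2)
    refine (h2.sum_le_tsum _ fun _ _ => by positivity).trans ?_
    rw [tsum_mul_left, tsum_geometric_of_lt_one (by positivity) hRinv]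
    have h3 : (R⁻¹) ^ 2 * (1 - (R⁻¹) ^ 2)⁻¹ = (R ^ 2 - 1)⁻¹ := by
      have : R ^ 2 - 1 ≠ 0 := by nlinarith
      have h0 : R ≠ 0 := by linarith
      have : 1 - (R⁻¹) ^ 2 = (R⁻¹) ^ 2 * (R ^ 2 - 1) := by field_simp
      rw [this, mul_inv, ← mul_assoc, mul_inv_cancel₀ (by positivity), one_mul]
    rw [h3]
    have h4 : 3 / 2 * (D / (1 - μ)) = (2 * ((1 - μ) / (3 * D)))⁻¹ := by
      have : 1 - μ ≠ 0 := by linarith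
      field_simp
    rw [h4]
    refine inv_anti₀ (by positivity) ?_
    rw [hRdef]
    nlinarith
  refine Real.tsum_le_of_sum_range_le (fun _ => norm_nonneg _) fun J => ?_
  have hCS := Finset.sum_mul_sq_le_sq_mul_sq (Finset.range J)
    (fun k => R ^ (k + 1) * ‖coeff (k + 1) b‖) fun k => (R⁻¹) ^ (k + 1)
  have hprod : ∀ k, R ^ (k + 1) * ‖coeff (k + 1) b‖ * (R⁻¹) ^ (k + 1) = ‖coeff (k + 1) b‖ := by
    intro k
    have h0 : R ^ (k + 1) ≠ 0 := pow_ne_zero _ (by linarith)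
    rw [inv_pow]
    field_simp
  simp only [hprod] at hCS
  have hfirst : ∑ k ∈ Finset.range J, (R ^ (k + 1) * ‖coeff (k + 1) b‖) ^ 2 ≤
      Real.exp 1 ^ 2 := by
    simp only [← hcoeff]
    refine ((((summable_nat_add_iff 1).2 hcs).sum_le_tsum _ fun _ _ => by positivity).trans ?_)
    refine le_trans ?_ hsq
    exact tsum_comp_le_tsum_of_inj hcs (fun _ => by positivity) (i := fun k : ℕ => k + 1)
      (add_left_injective 1)
  have hfinal : (∑ k ∈ Finset.range J, ‖coeff (k + 1) b‖) ^ 2 ≤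
      (2 * Real.exp 1 * (√D / √(1 - μ))) ^ 2 := by
    refine hCS.trans ((mul_le_mul hfirst (hgeom J) (by positivity) (by positivity)).trans ?_)
    rw [mul_pow, mul_pow, div_pow, Real.sq_sqrt (by linarith), Real.sq_sqrt (by linarith)]
    have : 0 ≤ D / (1 - μ) := div_nonneg (by linarith) (by linarith)
    have h2 : 0 ≤ Real.exp 1 ^ 2 * (D / (1 - μ)) := by positivity
    nlinarith
  exact le_of_sq_le_sq hfinal (by positivity)

theorem norm_inv_blaschkeProd_eq (s : Multiset ℂ) {z : ℂ} (hz : z ≠ 0) :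
    ‖1 / blaschkeProd s z‖ = ‖blaschkeProd s (conj z)⁻¹‖ := by
  rw [blaschkeProd_inv_conj s hz, RCLike.norm_conj, one_div]

/-- The Bernstein-type bound is applied to `b (z / r)`. Its values on the unit circle are those of
`B` on `|z| = 1 / r`, whose moduli are, by reflection, those of `1 / B` on `|z| = r`. -/
theorem norm_coeff_blaschkeSeries_le {s : Multiset ℂ} {r : ℝ} (hr : 0 < r)
    (hs : ∀ a ∈ s, ‖a‖ < r) (l : ℕ) :
    l * ‖coeff l (blaschkeSeries s)‖ ≤ r ^ l * (s.card *
      ⨆ z : Metric.sphere (0 : ℂ) r, ‖1 / blaschkeProd s z‖) := by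
  have hsR : ∀ a ∈ s, ‖a‖ * r⁻¹ < 1 := by
    intro a ha
    rw [← div_eq_mul_inv, div_lt_one hr]
    exact hs a ha
  obtain ⟨hc, hev⟩ := wiener_rescale_blaschkeSeries (inv_nonneg.2 hr.le) hsR
  have hval : ∀ z : ℂ, ‖z‖ = r → ‖1 / blaschkeProd s z‖ =
      ‖wienerEval (rescale ((r⁻¹ : ℝ) : ℂ) (blaschkeSeries s)) (r * (conj z)⁻¹)‖ := by
    intro z hz
    have hz0 : z ≠ 0 := by
      rw [← norm_pos_iff, hz]
      exact hr
    have h1 : ‖(r : ℂ) * (conj z)⁻¹‖ = 1 := by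
      rw [norm_mul, norm_inv, RCLike.norm_conj, hz, Complex.norm_real,
        Real.norm_of_nonneg hr.le, mul_inv_cancel₀ hr.ne']
    rw [norm_inv_blaschkeProd_eq s hz0, hev _ h1.le, ← mul_assoc, ← Complex.ofReal_mul,
      inv_mul_cancel₀ hr.ne', Complex.ofReal_one, one_mul]
  -- An unbounded real `⨆` would be `0`, so boundedness must be shown before the supremum can serve
  -- as a bound.
  have hbdd : BddAbove (Set.range fun z : Metric.sphere (0 : ℂ) r => ‖1 / blaschkeProd s z‖) := by
    refine ⟨∑' k, ‖coeff k (rescale ((r⁻¹ : ℝ) : ℂ) (blaschkeSeries s))‖, ?_⟩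
    rintro _ ⟨⟨z, hz⟩, rfl⟩
    have hz' : ‖z‖ = r := by simpa using hz
    have h1 : ‖(r : ℂ) * (conj z)⁻¹‖ = 1 := by
      rw [norm_mul, norm_inv, RCLike.norm_conj, hz', Complex.norm_real,
        Real.norm_of_nonneg hr.le, mul_inv_cancel₀ hr.ne']
    simp only [hval z hz']
    refine (norm_tsum_le_tsum_norm (hc.summable_eval h1.le)).trans (le_of_eq ?_)
    refine tsum_congr fun k => ?_
    rw [norm_mul, norm_pow, h1, one_pow, mul_one]
  have hM : ∀ w : ℂ, ‖w‖ = 1 →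
      ‖wienerEval (rescale ((r⁻¹ : ℝ) : ℂ) (blaschkeSeries s)) w‖ ≤
        ⨆ z : Metric.sphere (0 : ℂ) r, ‖1 / blaschkeProd s z‖ := by
    intro w hw
    have hw0 : w ≠ 0 := by
      rw [← norm_pos_iff, hw]
      exact one_pos
    have hz : ‖(r : ℂ) * (conj w)⁻¹‖ = r := by
      rw [norm_mul, norm_inv, RCLike.norm_conj, hw, Complex.norm_real,
        Real.norm_of_nonneg hr.le, inv_one, mul_one]
    have hinv : (r : ℂ) * (conj ((r : ℂ) * (conj w)⁻¹))⁻¹ = w := by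
      have : (r : ℂ) ≠ 0 := by exact_mod_cast hr.ne'
      simp only [map_mul, map_inv₀, Complex.conj_conj, Complex.conj_ofReal]
      field_simp
    have h1 := le_ciSup hbdd ⟨(r : ℂ) * (conj w)⁻¹, by simpa using hz⟩
    simp only [hval _ hz, hinv] at h1
    exact h1
  obtain ⟨q, hq⟩ := exists_recurrence_blaschkeSeries s
  have hbern := mul_norm_coeff_le_of_recurrence hc hM (D := s.card)
    (fun i => q i * ((r⁻¹ : ℝ) : ℂ) ^ (i + 1)) (fun k hk => by
      rw [coeff_rescale, hq k hk, Finset.mul_sum]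
      refine Finset.sum_congr rfl fun i hi => ?_
      have hi' := Finset.mem_range.1 hi
      rw [coeff_rescale, show ((r⁻¹ : ℝ) : ℂ) ^ k =
        ((r⁻¹ : ℝ) : ℂ) ^ (i + 1) * ((r⁻¹ : ℝ) : ℂ) ^ (k - 1 - i) by
          rw [← pow_add]; congr 1; omega]
      ring) l
  rw [coeff_rescale, norm_mul, norm_pow, Complex.norm_real,
    Real.norm_of_nonneg (inv_nonneg.2 hr.le), inv_pow] at hbern
  calc _ = r ^ l * (l * ((r ^ l)⁻¹ * ‖coeff l (blaschkeSeries s)‖)) := by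
        have : r ^ l ≠ 0 := by positivity
        field_simp
    _ ≤ _ := by gcongr

theorem norm_le_of_recurrence {s : Multiset ℂ} {μ : ℝ} (hμ0 : 0 < μ) (hμ1 : μ < 1)
    (hs : ∀ a ∈ s, ‖a‖ ≤ μ) (hcard : 0 < s.card) {n : ℕ} (hn : μ / (1 - μ) < n)
    {x : ℕ → ℂ} {K : ℝ} (hx : ∀ k, ‖x k‖ ≤ K)
    (hrec : ∀ t, ∑ i ∈ Finset.range (s.card + 1),
      ((s.map fun a => (Polynomial.X - Polynomial.C a)).prod).coeff i * x (i + t) = 0) :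
    ‖x n‖ ≤ μ ^ (n + 1) *
        (2 * K * Real.exp 1 ^ 2 * √(s.card : ℝ) * (s.card + 1) /
          (n * (1 - (1 + 1 / (n : ℝ)) * μ) ^ (3 / 2 : ℝ))) *
        ⨆ z : Metric.sphere (0 : ℂ) (μ * (1 + 1 / (n : ℝ))), ‖1 / blaschkeProd s z‖ := by
  have hK : 0 ≤ K := (norm_nonneg _).trans (hx 0)
  have hn0 : (0 : ℝ) < n := (div_pos hμ0 (by linarith)).trans hn
  have hinv : (0 : ℝ) < 1 / (n : ℝ) := by positivity
  -- This radius exceeds `μ`, and `r < 1` follows from `n > μ / (1 - μ)`.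
  set r : ℝ := μ * (1 + 1 / (n : ℝ)) with hrdef
  have hμr : μ < r := by nlinarith
  have hr0 : 0 < r := hμ0.trans hμr
  have hr1 : r < 1 := by
    rw [div_lt_iff₀ (by linarith)] at hn
    have : r = (μ * n + μ) / n := by rw [hrdef]; field_simp
    rw [this, div_lt_one hn0]
    linarith
  set M := ⨆ z : Metric.sphere (0 : ℂ) r, ‖1 / blaschkeProd s z‖
  have hM0 : 0 ≤ M := Real.iSup_nonneg fun _ => norm_nonneg _
  set D : ℝ := (s.card : ℝ) with hDdef
  have hD0 : 0 ≤ D := by positivity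
  have h1 := norm_le_tsum_mul_tsum (fun a ha => (hs a ha).trans_lt hμ1) hx hrec n
  have h2 := sum_norm_coeff_blaschkeSeries_le hμ0.le hμ1 hs hcard
  have hcoef := norm_coeff_blaschkeSeries_le hr0 fun a ha => (hs a ha).trans_lt hμr
  set b := blaschkeSeries s
  have h3 : ∑' k, ‖coeff (n + k + 1) b‖ ≤ r ^ (n + 1) / (n + 1) * (D * M) * (1 - r)⁻¹ := by
    have hg := (summable_geometric_of_lt_one hr0.le hr1).mul_left (r ^ (n + 1) / (n + 1) * (D * M))
    rw [← tsum_geometric_of_lt_one hr0.le hr1, ← tsum_mul_left]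
    have hle : ∀ k, ‖coeff (n + k + 1) b‖ ≤ r ^ (n + 1) / (n + 1) * (D * M) * r ^ k := by
      intro k
      have h4 := hcoef (n + k + 1)
      have h5 : ((n : ℝ) + 1) * ‖coeff (n + k + 1) b‖ ≤
          ((n + k + 1 : ℕ) : ℝ) * ‖coeff (n + k + 1) b‖ := by
        gcongr
        push_cast
        linarith [(Nat.cast_nonneg k : (0 : ℝ) ≤ k)]
      have h6 := h5.trans h4
      rw [mul_comm, ← le_div_iff₀ (by positivity)] at h6
      refine h6.trans (le_of_eq ?_)
      rw [show n + k + 1 = n + 1 + k by ring, pow_add]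
      ring
    exact Summable.tsum_le_tsum hle (Summable.of_nonneg_of_le (fun _ => norm_nonneg _) hle hg) hg
  have h4 : r ^ (n + 1) / (n + 1) ≤ μ ^ (n + 1) * Real.exp 1 / n := by
    have h5 : (1 + 1 / (n : ℝ)) ^ n ≤ Real.exp 1 := by
      have h6 : 1 + 1 / (n : ℝ) ≤ Real.exp (1 / n) := by
        have := Real.add_one_le_exp (1 / (n : ℝ))
        linarith
      calc (1 + 1 / (n : ℝ)) ^ n ≤ Real.exp (1 / n) ^ n := by gcongr
        _ = Real.exp 1 := by
          rw [← Real.exp_nat_mul]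
          congr 1
          exact mul_one_div_cancel hn0.ne'
    -- One of the `n + 1` factors `(n + 1) / n` turns `1 / (n + 1)` into `1 / n`; the other `n` give
    -- at most `e`.
    have h7 : r ^ (n + 1) / (n + 1) = μ ^ (n + 1) * (1 + 1 / (n : ℝ)) ^ n / n := by
      rw [hrdef, mul_pow, pow_succ (1 + 1 / (n : ℝ))]
      have : 1 + 1 / (n : ℝ) = (n + 1) / n := by field_simp
      rw [this]
      generalize (((n : ℝ) + 1) / n) ^ n = y
      field_simp
    rw [h7]
    gcongr
  have h1r : 0 < 1 - r := by linarith
  -- Weakening `1 - μ` to `1 - r` merges this factor with the geometric sum into the power `3 / 2`.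
  have h8 : √D / √(1 - μ) ≤ √D / √(1 - r) := by
    gcongr
  have h9 : (1 - (1 + 1 / (n : ℝ)) * μ) ^ (3 / 2 : ℝ) = (1 - r) * √(1 - r) := by
    rw [show 1 - (1 + 1 / (n : ℝ)) * μ = 1 - r by rw [hrdef]; ring,
      show (3 / 2 : ℝ) = 1 + 1 / 2 by norm_num, Real.rpow_add h1r, Real.rpow_one,
      Real.sqrt_eq_rpow]
  rw [h9]
  calc ‖x n‖ ≤ K * ((∑' k, ‖coeff (n + k + 1) b‖) * ∑' k, ‖coeff (k + 1) b‖) := h1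
    _ ≤ K * ((μ ^ (n + 1) * Real.exp 1 / n * (D * M) * (1 - r)⁻¹) *
        (2 * Real.exp 1 * (√D / √(1 - r)))) := by
      gcongr
      · exact h3.trans (by gcongr)
      · exact h2.trans (by gcongr)
    _ = μ ^ (n + 1) * (2 * K * Real.exp 1 ^ 2 * √D * D / (n * ((1 - r) * √(1 - r)))) * M := by
      have : √(1 - r) ≠ 0 := (Real.sqrt_pos.2 h1r).ne'
      field_simp
    _ ≤ _ := by
      have : 0 ≤ √(1 - r) := Real.sqrt_nonneg _
      gcongr
      linarith

end Bound

/-! ### The peripheral part of an endomorphism with bounded orbits -/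

section Peripheral

open Filter Topology

theorem tendsto_zero_of_le_mul_add {u ε : ℕ → ℝ} {ρ : ℝ} (hu : ∀ k, 0 ≤ u k) (hρ0 : 0 ≤ ρ)
    (hρ1 : ρ < 1) (hε : Tendsto ε atTop (𝓝 0)) (h : ∀ k, u (k + 1) ≤ ρ * u k + ε k) :
    Tendsto u atTop (𝓝 0) := by
  rw [Metric.tendsto_atTop]
  intro e he
  have h1 : 0 < e / 2 * (1 - ρ) := mul_pos (by linarith) (by linarith)
  -- Past `J` the error is below `e / 2 * (1 - ρ)`, for which `e / 2` is the fixed point, so the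
  -- excess over `e / 2` contracts by `ρ`.
  obtain ⟨J, hJ⟩ := (hε.eventually (gt_mem_nhds h1)).exists_forall_of_atTop
  have h2 : ∀ j, u (J + j) - e / 2 ≤ ρ ^ j * u J := by
    intro j
    induction j with
    | zero => simp; linarith
    | succ j ih =>
      have h3 := h (J + j)
      have h4 := (hJ (J + j) (by omega)).le
      rw [← add_assoc, pow_succ]
      nlinarith
  have h5 : Tendsto (fun j => ρ ^ j * u J) atTop (𝓝 0) := by
    simpa using (tendsto_pow_atTop_nhds_zero_of_lt_one hρ0 hρ1).mul_const (u J)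
  obtain ⟨I, hI⟩ := (h5.eventually (gt_mem_nhds (half_pos he))).exists_forall_of_atTop
  refine ⟨J + I, fun k hk => ?_⟩
  obtain ⟨j, rfl⟩ := Nat.exists_eq_add_of_le (show J ≤ k by omega)
  have h6 := h2 j
  have h7 := hI j (by omega)
  rw [Real.dist_eq, sub_zero, abs_of_nonneg (hu _)]
  linarith

/-- By compactness the power vectors converge along some `φ`; the exponents `φ (2 * j) - φ j ≥ j`
give quotients of terms with the same nonzero limit. -/
theorem exists_tendsto_pow_one (s : Finset ℂ) (hs : ∀ ν ∈ s, ‖ν‖ = 1) :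
    ∃ k : ℕ → ℕ, Tendsto k atTop atTop ∧ ∀ ν ∈ s, Tendsto (fun j => ν ^ k j) atTop (𝓝 1) := by
  have hbdd : Bornology.IsBounded (Set.range fun k : ℕ => fun ν : s => (ν : ℂ) ^ k) := by
    rw [isBounded_iff_forall_norm_le]
    refine ⟨1, ?_⟩
    rintro _ ⟨k, rfl⟩
    refine (pi_norm_le_iff_of_nonneg zero_le_one).2 fun ν => ?_
    rw [norm_pow, hs ν ν.2, one_pow]
  obtain ⟨a, -, φ, hφ, ha⟩ := tendsto_subseq_of_bounded hbdd (fun k => Set.mem_range_self k)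
  have hmono : ∀ j i, φ j + i ≤ φ (j + i) := by
    intro j i
    induction i with
    | zero => simp
    | succ i ih =>
      have := hφ (Nat.lt_succ_self (j + i))
      rw [← add_assoc]
      exact Nat.succ_le_of_lt (ih.trans_lt this)
  refine ⟨fun j => φ (j + j) - φ j, ?_, fun ν hν => ?_⟩
  · refine tendsto_atTop_mono (fun j => ?_) tendsto_id
    have := hmono j j
    simp only [id]
    omega
  · have h1 : Tendsto (fun j => ν ^ φ j) atTop (𝓝 (a ⟨ν, hν⟩)) := (tendsto_pi_nhds.1 ha) ⟨ν, hν⟩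
    have h2 : Tendsto (fun j => ν ^ φ (j + j)) atTop (𝓝 (a ⟨ν, hν⟩)) :=
      h1.comp (tendsto_atTop_mono (fun j => Nat.le_add_left j j) tendsto_id)
    have hν0 : ν ≠ 0 := by
      rw [← norm_pos_iff, hs ν hν]
      exact one_pos
    have hnorm : ‖a ⟨ν, hν⟩‖ = 1 := by
      refine tendsto_nhds_unique h1.norm ?_
      simp only [norm_pow, hs ν hν, one_pow]
      exact tendsto_const_nhds
    have ha0 : a ⟨ν, hν⟩ ≠ 0 := by
      rw [← norm_pos_iff, hnorm]
      exact one_pos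
    have h3 := h2.div h1 ha0
    rw [div_self ha0] at h3
    refine h3.congr fun j => ?_
    have : φ j ≤ φ (j + j) := (Nat.le_add_right _ _).trans (hmono j j)
    simp only [Pi.div_apply]
    rw [pow_sub₀ _ hν0 this, div_eq_mul_inv]

variable {W : Type*} [NormedAddCommGroup W] [NormedSpace ℂ W]

theorem pow_apply_of_apply_eq_smul {T : Module.End ℂ W} {ν : ℂ} {w : W} (h : T w = ν • w) (k : ℕ) :
    (T ^ k) w = ν ^ k • w := by
  induction k with
  | zero => simp
  | succ k ih => rw [pow_succ, Module.End.mul_apply, h, map_smul, ih, smul_smul, pow_succ']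

/-- A nontrivial Jordan chain at `|ν| ≥ 1` would make the orbit grow at least linearly. -/
theorem apply_eq_smul_of_sq {T : Module.End ℂ W} (hT : ∀ w, ∃ K : ℝ, ∀ k, ‖(T ^ k) w‖ ≤ K)
    {ν : ℂ} (hν : 1 ≤ ‖ν‖) {w : W}
    (hw : (T - ν • 1) ((T - ν • 1) w) = 0) : (T - ν • 1) w = 0 := by
  set y := (T - ν • 1) w with hy
  have hTy : T y = ν • y := by
    simpa [sub_eq_zero] using hw
  have hTw : T w = ν • w + y := by
    rw [hy]
    simp
  -- The extra factor `ν` avoids the exponent `k - 1`.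
  have hpow : ∀ k : ℕ, ν • (T ^ k) w = ν ^ k • (ν • w + (k : ℂ) • y) := by
    intro k
    induction k with
    | zero => simp
    | succ k ih =>
      rw [pow_succ', Module.End.mul_apply, ← map_smul, ih, map_smul, map_add, map_smul, map_smul,
        hTw, hTy]
      push_cast
      module
  obtain ⟨K, hK⟩ := hT w
  have hbd : ∀ k : ℕ, (k : ℝ) * ‖y‖ ≤ ‖ν‖ * K + ‖ν‖ * ‖w‖ := by
    intro k
    have h1 : ‖ν • w + (k : ℂ) • y‖ ≤ ‖ν‖ * K := by
      calc ‖ν • w + (k : ℂ) • y‖ ≤ ‖ν‖ ^ k * ‖ν • w + (k : ℂ) • y‖ :=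
            le_mul_of_one_le_left (norm_nonneg _) (one_le_pow₀ hν)
        _ = ‖ν‖ * ‖(T ^ k) w‖ := by rw [← norm_pow, ← norm_smul, ← hpow, norm_smul]
        _ ≤ ‖ν‖ * K := by gcongr; exact hK k
    have h2 : ‖(k : ℂ) • y‖ ≤ ‖ν • w + (k : ℂ) • y‖ + ‖ν • w‖ := by
      have := norm_sub_le (ν • w + (k : ℂ) • y) (ν • w)
      simpa using this
    rw [norm_smul, norm_smul, Complex.norm_natCast] at h2
    linarith
  by_contra h0
  have hy0 : 0 < ‖y‖ := norm_pos_iff.2 h0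
  obtain ⟨k, hk⟩ := exists_nat_gt ((‖ν‖ * K + ‖ν‖ * ‖w‖) / ‖y‖)
  rw [div_lt_iff₀ hy0] at hk
  exact absurd (hbd k) (not_le.2 hk)

theorem apply_eq_smul_of_mem_maxGenEigenspace {T : Module.End ℂ W}
    (hT : ∀ w, ∃ K : ℝ, ∀ k, ‖(T ^ k) w‖ ≤ K) {ν : ℂ} (hν : 1 ≤ ‖ν‖) {w : W}
    (hw : w ∈ T.maxGenEigenspace ν) : T w = ν • w := by
  rw [Module.End.mem_maxGenEigenspace] at hw
  obtain ⟨k, hk⟩ := hw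
  have key : ∀ k : ℕ, ((T - ν • 1) ^ (k + 1)) w = 0 → (T - ν • 1) w = 0 := by
    intro k
    induction k with
    | zero => simp
    | succ k ih =>
      intro h
      apply ih
      rw [pow_succ', Module.End.mul_apply]
      apply apply_eq_smul_of_sq hT hν
      rwa [← Module.End.mul_apply, ← Module.End.mul_apply, ← sq, ← pow_add, add_comm]
  have := key k (by rw [pow_succ', Module.End.mul_apply, hk, map_zero])
  simpa [sub_eq_zero] using this

theorem eq_zero_of_mem_maxGenEigenspace {T : Module.End ℂ W}
    (hT : ∀ w, ∃ K : ℝ, ∀ k, ‖(T ^ k) w‖ ≤ K) {ν : ℂ} (hν : 1 < ‖ν‖) {w : W}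
    (hw : w ∈ T.maxGenEigenspace ν) : w = 0 := by
  have h1 := pow_apply_of_apply_eq_smul (apply_eq_smul_of_mem_maxGenEigenspace hT hν.le hw)
  obtain ⟨K, hK⟩ := hT w
  by_contra h0
  have hw0 : 0 < ‖w‖ := norm_pos_iff.2 h0
  obtain ⟨k, hk⟩ := pow_unbounded_of_one_lt (K / ‖w‖) hν
  rw [div_lt_iff₀ hw0, ← norm_pow, ← norm_smul, ← h1] at hk
  exact absurd (hK k) (not_le.2 hk)

theorem tendsto_pow_apply_of_mem_maxGenEigenspace {T : Module.End ℂ W} {ν : ℂ} (hν : ‖ν‖ < 1)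
    {w : W} (hw : w ∈ T.maxGenEigenspace ν) : Tendsto (fun k => (T ^ k) w) atTop (𝓝 0) := by
  rw [Module.End.mem_maxGenEigenspace] at hw
  obtain ⟨k, hk⟩ := hw
  induction k generalizing w with
  | zero =>
    have : w = 0 := by simpa using hk
    simp [this]
  | succ k ih =>
    have h1 := ih (w := (T - ν • 1) w) (by rwa [← Module.End.mul_apply, ← pow_succ])
    rw [tendsto_zero_iff_norm_tendsto_zero] at h1 ⊢
    refine tendsto_zero_of_le_mul_add (fun _ => norm_nonneg _) (norm_nonneg ν) hν h1 fun j => ?_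
    have h2 : (T ^ (j + 1)) w = ν • (T ^ j) w + (T ^ j) ((T - ν • 1) w) := by
      rw [pow_succ, Module.End.mul_apply, ← map_smul, ← map_add]
      simp
    rw [h2, ← norm_smul]
    exact norm_add_le _ _

variable [FiniteDimensional ℂ W]

theorem spectralProjection_apply_of_mem {T : Module.End ℂ W} {ν : ℂ} {w : W}
    (hw : w ∈ T.maxGenEigenspace ν) : spectralProjection T ν w = w :=
  Submodule.projection_apply_left (isCompl_maxGenEigenspace T ν) ⟨w, hw⟩

theorem spectralProjection_apply_of_mem_of_ne {T : Module.End ℂ W} {ν κ : ℂ} (h : κ ≠ ν) {w : W}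
    (hw : w ∈ T.maxGenEigenspace κ) : spectralProjection T ν w = 0 :=
  (Submodule.projection_apply_eq_zero_iff (isCompl_maxGenEigenspace T ν)).2
    ((le_iSup₂_of_le (f := fun κ (_ : κ ≠ ν) => T.maxGenEigenspace κ) κ h le_rfl) hw)

theorem peripheralPart_apply_of_norm_ne_one {T : Module.End ℂ W} {κ : ℂ} (hκ : ‖κ‖ ≠ 1) {w : W}
    (hw : w ∈ T.maxGenEigenspace κ) : peripheralPart T w = 0 := by
  rw [peripheralPart, LinearMap.sum_apply]
  refine Finset.sum_eq_zero fun ν hν => ?_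
  have hne : κ ≠ ν := by
    rintro rfl
    exact hκ (Finset.mem_filter.1 hν).2
  rw [LinearMap.smul_apply, spectralProjection_apply_of_mem_of_ne hne hw, smul_zero]

theorem peripheralPart_apply_of_norm_eq_one {T : Module.End ℂ W}
    (hT : ∀ w, ∃ K : ℝ, ∀ k, ‖(T ^ k) w‖ ≤ K) {κ : ℂ} (hκ : ‖κ‖ = 1) {w : W}
    (hw : w ∈ T.maxGenEigenspace κ) : peripheralPart T w = κ • w := by
  by_cases h0 : w = 0
  · simp [h0]
  have hTw := apply_eq_smul_of_mem_maxGenEigenspace hT hκ.ge hw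
  have heig : T.HasEigenvalue κ :=
    Module.End.hasEigenvalue_of_hasEigenvector ⟨Module.End.mem_eigenspace_iff.2 hTw, h0⟩
  rw [peripheralPart, LinearMap.sum_apply, Finset.sum_eq_single κ]
  · rw [LinearMap.smul_apply, spectralProjection_apply_of_mem hw]
  · intro ν _ hν
    rw [LinearMap.smul_apply, spectralProjection_apply_of_mem_of_ne hν.symm hw, smul_zero]
  · intro h
    exact absurd (Finset.mem_filter.2 ⟨T.finite_hasEigenvalue.mem_toFinset.2 heig, hκ⟩) h

theorem induction_maxGenEigenspace (T : Module.End ℂ W) {p : W → Prop}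
    (mem : ∀ κ, ∀ w ∈ T.maxGenEigenspace κ, p w) (add : ∀ x y, p x → p y → p (x + y)) (w : W) :
    p w :=
  Submodule.iSup_induction (fun κ => T.maxGenEigenspace κ) (motive := p)
    (by rw [Module.End.iSup_maxGenEigenspace_eq_top]; trivial) mem
    (mem 0 0 (Submodule.zero_mem _)) add

/-- On generalized eigenspaces of modulus one both maps are the same scalar; on the others, which
`T` preserves, the peripheral part vanishes. -/
theorem mul_peripheralPart {T : Module.End ℂ W} (hT : ∀ w, ∃ K : ℝ, ∀ k, ‖(T ^ k) w‖ ≤ K) :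
    T * peripheralPart T = peripheralPart T * peripheralPart T ∧
      peripheralPart T * T = peripheralPart T * peripheralPart T := by
  have key : ∀ w, T (peripheralPart T w) = peripheralPart T (peripheralPart T w) ∧
      peripheralPart T (T w) = peripheralPart T (peripheralPart T w) := by
    refine induction_maxGenEigenspace T (fun κ w hw => ?_) fun x y hx hy => ?_
    · by_cases hκ : ‖κ‖ = 1
      · have h1 := peripheralPart_apply_of_norm_eq_one hT hκ hw
        have h2 := apply_eq_smul_of_mem_maxGenEigenspace hT hκ.ge hw
        simp [h1, h2]
      · have h1 := peripheralPart_apply_of_norm_ne_one hκ hw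
        have h2 := peripheralPart_apply_of_norm_ne_one hκ
          (T.mapsTo_maxGenEigenspace_of_comm (Commute.refl T) κ hw)
        simp [h1, h2]
    · simp only [map_add]
      exact ⟨by rw [hx.1, hy.1], by rw [hx.2, hy.2]⟩
  exact ⟨LinearMap.ext fun w => (key w).1, LinearMap.ext fun w => (key w).2⟩

/-- Along exponents that bring all unimodular eigenvalues to `1` simultaneously, the part inside the
disc decays. The case `m = 0` is excluded because the zeroth power of the peripheral part does not
kill that part. -/
theorem exists_tendsto_pow_peripheralPart {T : Module.End ℂ W}
    (hT : ∀ w, ∃ K : ℝ, ∀ k, ‖(T ^ k) w‖ ≤ K) :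
    ∃ k : ℕ → ℕ, ∀ m, m ≠ 0 → ∀ w,
      Tendsto (fun j => (T ^ (k j + m)) w) atTop (𝓝 ((peripheralPart T ^ m) w)) := by
  obtain ⟨k, hk, hk1⟩ := exists_tendsto_pow_one
    {ν ∈ T.finite_hasEigenvalue.toFinset | ‖ν‖ = 1} fun ν hν => (Finset.mem_filter.1 hν).2
  refine ⟨k, fun m hm => ?_⟩
  refine induction_maxGenEigenspace T (p := fun w => Tendsto (fun j => (T ^ (k j + m)) w) atTop
    (𝓝 ((peripheralPart T ^ m) w))) (fun κ w hw => ?_) fun x y hx hy => ?_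
  · rcases lt_trichotomy ‖κ‖ 1 with h | h | h
    · have h1 : (peripheralPart T ^ m) w = 0 := by
        obtain ⟨m, rfl⟩ := Nat.exists_eq_succ_of_ne_zero hm
        rw [pow_succ, Module.End.mul_apply, peripheralPart_apply_of_norm_ne_one h.ne hw, map_zero]
      rw [h1]
      exact (tendsto_pow_apply_of_mem_maxGenEigenspace h hw).comp
        (tendsto_atTop_mono (fun j => Nat.le_add_right (k j) m) hk)
    · by_cases h0 : w = 0
      · simp [h0]
      have hTw := apply_eq_smul_of_mem_maxGenEigenspace hT h.ge hw
      have heig : T.HasEigenvalue κ :=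
        Module.End.hasEigenvalue_of_hasEigenvector ⟨Module.End.mem_eigenspace_iff.2 hTw, h0⟩
      rw [pow_apply_of_apply_eq_smul (peripheralPart_apply_of_norm_eq_one hT h hw)]
      simp only [pow_apply_of_apply_eq_smul hTw]
      simp only [pow_add]
      have := (hk1 κ (Finset.mem_filter.2 ⟨T.finite_hasEigenvalue.mem_toFinset.2 heig, h⟩)).mul_const (κ ^ m)
      rw [one_mul] at this
      exact this.smul_const w
    · simp [eq_zero_of_mem_maxGenEigenspace hT h hw]
  · simp only [map_add]
    exact hx.add hy

theorem tendsto_pow_sub_peripheralPart {T : Module.End ℂ W}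
    (hT : ∀ w, ∃ K : ℝ, ∀ k, ‖(T ^ k) w‖ ≤ K) (w : W) :
    Tendsto (fun k => ((T - peripheralPart T) ^ k) w) atTop (𝓝 0) := by
  refine induction_maxGenEigenspace T (p := fun w => Tendsto
    (fun k => ((T - peripheralPart T) ^ k) w) atTop (𝓝 0)) (fun κ w hw => ?_)
    (fun x y hx hy => ?_) w
  · rcases lt_trichotomy ‖κ‖ 1 with h | h | h
    · have hmem : ∀ k, (T ^ k) w ∈ T.maxGenEigenspace κ := fun k =>
        T.mapsTo_maxGenEigenspace_of_comm (Commute.pow_right (Commute.refl T) k) κ hw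
      have h1 : ∀ k, ((T - peripheralPart T) ^ k) w = (T ^ k) w := by
        intro k
        induction k with
        | zero => simp
        | succ k ih =>
          rw [pow_succ', Module.End.mul_apply, ih, LinearMap.sub_apply,
            peripheralPart_apply_of_norm_ne_one h.ne (hmem k), sub_zero, pow_succ' T,
            Module.End.mul_apply]
      simp only [h1]
      exact tendsto_pow_apply_of_mem_maxGenEigenspace h hw
    · have h1 : (T - peripheralPart T) w = 0 := by
        rw [LinearMap.sub_apply, peripheralPart_apply_of_norm_eq_one hT h hw,
          apply_eq_smul_of_mem_maxGenEigenspace hT h.ge hw, sub_self]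
      refine tendsto_const_nhds.congr' ?_
      filter_upwards [eventually_gt_atTop 0] with k hk
      obtain ⟨k, rfl⟩ := Nat.exists_eq_succ_of_ne_zero hk.ne'
      rw [pow_succ, Module.End.mul_apply, h1, map_zero]
    · simp [eq_zero_of_mem_maxGenEigenspace hT h hw]
  · simp only [map_add]
    simpa using hx.add hy

theorem norm_lt_one_of_hasEigenvalue_sub_peripheralPart {T : Module.End ℂ W}
    (hT : ∀ w, ∃ K : ℝ, ∀ k, ‖(T ^ k) w‖ ≤ K) {ν : ℂ}
    (hν : (T - peripheralPart T).HasEigenvalue ν) : ‖ν‖ < 1 := by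
  obtain ⟨w, hw, hw0⟩ := hν.exists_hasEigenvector
  have h1 := tendsto_pow_sub_peripheralPart hT w
  simp only [pow_apply_of_apply_eq_smul (Module.End.mem_eigenspace_iff.1 hw)] at h1
  by_contra hlt
  have h2 : ∀ k : ℕ, ‖w‖ ≤ ‖ν ^ k • w‖ := fun k => by
    rw [norm_smul, norm_pow]
    exact le_mul_of_one_le_left (norm_nonneg _) (one_le_pow₀ (not_lt.1 hlt))
  have h3 := ge_of_tendsto' h1.norm h2
  rw [norm_zero] at h3
  exact hw0 (norm_le_zero_iff.1 h3)

end Peripheral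

/-! ### Transfer from the complexification -/

section Coordinates

open Filter Topology

variable {W : Type*} [AddCommGroup W] [Module ℂ W] [FiniteDimensional ℂ W]

/-- The properties of the peripheral part, in terms of coordinates. -/
theorem peripheralPart_properties {ι : Type*} [Fintype ι] (b : Module.Basis ι ℂ W)
    {T : Module.End ℂ W} (hT : ∀ w i, ∃ K : ℝ, ∀ k, ‖b.repr ((T ^ k) w) i‖ ≤ K) :
    (T * peripheralPart T = peripheralPart T * peripheralPart T ∧
      peripheralPart T * T = peripheralPart T * peripheralPart T) ∧
    (∃ k : ℕ → ℕ, ∀ m, m ≠ 0 → ∀ w i, Tendsto (fun j => b.repr ((T ^ (k j + m)) w) i) atTop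
      (𝓝 (b.repr ((peripheralPart T ^ m) w) i))) ∧
    ∀ ν, (T - peripheralPart T).HasEigenvalue ν → ‖ν‖ < 1 := by
  -- `W` carries no norm, so the sup norm of the coordinates is installed.
  let : NormedAddCommGroup W :=
    NormedAddCommGroup.induced W (ι → ℂ) b.equivFun b.equivFun.injective
  let : NormedSpace ℂ W := NormedSpace.induced ℂ W (ι → ℂ) b.equivFun
  have hbd : ∀ w, ∃ K : ℝ, ∀ k, ‖(T ^ k) w‖ ≤ K := by
    intro w
    choose K hK using hT w
    refine ⟨∑ i, |K i|, fun k => ?_⟩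
    have h0 : 0 ≤ ∑ i, |K i| := Finset.sum_nonneg fun _ _ => abs_nonneg _
    refine (pi_norm_le_iff_of_nonneg (x := b.equivFun ((T ^ k) w)) h0).2 fun i => ?_
    refine ((hK i k).trans (le_abs_self _)).trans ?_
    exact Finset.single_le_sum (f := fun i => |K i|) (fun _ _ => abs_nonneg _) (Finset.mem_univ i)
  refine ⟨mul_peripheralPart hbd, ?_, fun ν hν =>
    norm_lt_one_of_hasEigenvalue_sub_peripheralPart hbd hν⟩
  obtain ⟨k, hk⟩ := exists_tendsto_pow_peripheralPart hbd
  refine ⟨k, fun m hm w i => ?_⟩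
  have hcont : Continuous fun w => b.repr w i :=
    (b.coord i).continuous_of_finiteDimensional
  exact (hcont.tendsto _).comp (hk m hm w)

end Coordinates

/-! ### Finite-dimensional norms given as definite seminorms -/

section Seminorms

open Filter Topology

variable {𝕜 : Type*} [RCLike 𝕜] {E : Type*} [AddCommGroup E] [Module 𝕜 E]

theorem exists_norm_apply_le_mul [FiniteDimensional 𝕜 E] (N : Seminorm 𝕜 E) (hN : ∀ x, N x = 0 → x = 0)
    (L : E →ₗ[𝕜] 𝕜) : ∃ K : ℝ, 0 ≤ K ∧ ∀ x, ‖L x‖ ≤ K * N x := by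
  let : NormedAddCommGroup E := AddGroupNorm.toNormedAddCommGroup
    { N.toAddGroupSeminorm with eq_zero_of_map_eq_zero' := hN }
  let : NormedSpace 𝕜 E := ⟨fun a x => (map_smul_eq_mul N a x).le⟩
  exact ⟨‖L.toContinuousLinearMap‖, norm_nonneg _, L.toContinuousLinearMap.le_opNorm⟩

theorem exists_dual_eq_seminorm (N : Seminorm 𝕜 E) (hN : ∀ x, N x = 0 → x = 0) (x : E) :
    ∃ L : E →ₗ[𝕜] 𝕜, L x = (N x : 𝕜) ∧ ∀ y, ‖L y‖ ≤ N y := by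
  let : NormedAddCommGroup E := AddGroupNorm.toNormedAddCommGroup
    { N.toAddGroupSeminorm with eq_zero_of_map_eq_zero' := hN }
  let : NormedSpace 𝕜 E := ⟨fun a x => (map_smul_eq_mul N a x).le⟩
  obtain ⟨g, hg1, hg2⟩ := exists_dual_vector'' 𝕜 x
  refine ⟨g.toLinearMap, hg2, fun y => (g.le_opNorm y).trans ?_⟩
  exact mul_le_of_le_one_left (norm_nonneg y) hg1

theorem tendsto_seminorm_sub (N : Seminorm 𝕜 E) {ι : Type*} [Fintype ι] (B : Module.Basis ι 𝕜 E)
    {X : ℕ → E} {Y : E} (h : ∀ i, Tendsto (fun j => B.repr (X j) i) atTop (𝓝 (B.repr Y i))) :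
    Tendsto (fun j => N (X j - Y)) atTop (𝓝 0) := by
  have hle : ∀ j, N (X j - Y) ≤ ∑ i, ‖B.repr (X j) i - B.repr Y i‖ * N (B i) := by
    intro j
    conv_lhs => rw [← B.sum_repr (X j - Y)]
    refine (Finset.le_sum_of_subadditive N (map_zero N).le (map_add_le_add N) _ _).trans
      (Finset.sum_le_sum fun i _ => ?_)
    rw [map_smul_eq_mul, map_sub, Finsupp.sub_apply]
  refine squeeze_zero (fun _ => apply_nonneg N _) hle ?_
  rw [show (0 : ℝ) = ∑ i, 0 * N (B i) by simp]
  refine tendsto_finsetSum _ fun i _ => Tendsto.mul_const _ ?_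
  exact tendsto_iff_norm_sub_tendsto_zero.1 (h i)

end Seminorms

/-! ### Descent of the peripheral part to the original space -/

section Transfer

open Filter Topology

variable {𝕜 : Type*} [RCLike 𝕜] {V : Type*} [AddCommGroup V] [Module 𝕜 V] [Algebra 𝕜 ℂ]

theorem baseChange_pow_tmul (T : Module.End 𝕜 V) (k : ℕ) (c : ℂ) (v : V) :
    ((T.baseChange ℂ : Module.End ℂ (ℂ ⊗[𝕜] V)) ^ k) (c ⊗ₜ v) = c ⊗ₜ (T ^ k) v := by
  rw [← LinearMap.baseChange_pow, LinearMap.baseChange_tmul]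

/-- The retraction of the complexification onto `V` given by a retraction of `ℂ` onto `𝕜`. -/
def retraction (ρ : ℂ →ₗ[𝕜] 𝕜) : ℂ ⊗[𝕜] V →ₗ[𝕜] V :=
  (TensorProduct.lid 𝕜 V).toLinearMap ∘ₗ ρ.rTensor V

theorem retraction_tmul (ρ : ℂ →ₗ[𝕜] 𝕜) (c : ℂ) (v : V) :
    retraction ρ (c ⊗ₜ[𝕜] v) = ρ c • v := by
  simp [retraction]

/-- The complexification of `Tinf` is shown to be the peripheral part itself. Relations and
eigenvalue bounds then descend by injectivity of base change, and the bound on powers by passing to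
the limit in `N`. -/
theorem asymptotic_properties [FiniteDimensional 𝕜 V]
    (hnorm : ∀ a : 𝕜, ‖algebraMap 𝕜 ℂ a‖ = ‖a‖) (ρ : ℂ →ₗ[𝕜] 𝕜)
    (hρc : Continuous ρ) (hρ : ∀ a : 𝕜, ρ (algebraMap 𝕜 ℂ a) = a)
    (N : Seminorm 𝕜 (Module.End 𝕜 V)) (hN : ∀ X : Module.End 𝕜 V, N X = 0 → X = 0)
    (C : ℝ) (T Tinf : Module.End 𝕜 V) (hT : ∀ k : ℕ, N (T ^ k) ≤ C)
    (hTinf : ∀ v, Tinf v = retraction ρ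
      (peripheralPart (T.baseChange ℂ : Module.End ℂ (ℂ ⊗[𝕜] V)) (1 ⊗ₜ v))) :
    (∀ m, m ≠ 0 → N (Tinf ^ m) ≤ C) ∧ (T * Tinf = Tinf * Tinf ∧ Tinf * T = Tinf * Tinf) ∧
      ∀ ν, Module.End.HasEigenvalue ((T - Tinf).baseChange ℂ : Module.End ℂ (ℂ ⊗[𝕜] V)) ν → ‖ν‖ < 1 := by
  let b := Module.finBasis 𝕜 V
  let bW : Module.Basis _ ℂ (ℂ ⊗[𝕜] V) := b.baseChange ℂ
  set S : Module.End ℂ (ℂ ⊗[𝕜] V) := T.baseChange ℂ with hS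
  have hrepr : ∀ (c : ℂ) (v : V) i, bW.repr (c ⊗ₜ v) i = algebraMap 𝕜 ℂ (b.repr v i) * c := by
    intro c v i
    rw [Module.Basis.baseChange_repr_tmul, Algebra.smul_def]
  have hbd : ∀ w i, ∃ K : ℝ, ∀ k, ‖bW.repr ((S ^ k) w) i‖ ≤ K := by
    intro w i
    induction w using TensorProduct.induction_on with
    | zero => exact ⟨0, fun k => by simp⟩
    | tmul c v =>
      obtain ⟨K, hK0, hK⟩ := exists_norm_apply_le_mul N hN (b.coord i ∘ₗ LinearMap.applyₗ v)
      refine ⟨K * C * ‖c‖, fun k => ?_⟩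
      rw [hS, baseChange_pow_tmul, hrepr, norm_mul, hnorm]
      gcongr
      exact (hK (T ^ k)).trans (mul_le_mul_of_nonneg_left (hT k) hK0)
    | add x y hx hy =>
      obtain ⟨K, hK⟩ := hx
      obtain ⟨K', hK'⟩ := hy
      refine ⟨K + K', fun k => ?_⟩
      rw [map_add, map_add, Finsupp.add_apply]
      exact (norm_add_le _ _).trans (add_le_add (hK k) (hK' k))
  obtain ⟨⟨hP1, hP2⟩, ⟨k, hk⟩, hlt⟩ := peripheralPart_properties bW hbd
  set P := peripheralPart S
  have hretr : ∀ v : V, retraction ρ ((1 : ℂ) ⊗ₜ[𝕜] v) = v := by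
    intro v
    rw [retraction_tmul, ← map_one (algebraMap 𝕜 ℂ), hρ, one_smul]
  have hιc : Continuous (algebraMap 𝕜 ℂ) :=
    (AddMonoidHomClass.isometry_of_norm (algebraMap 𝕜 ℂ) hnorm).continuous
  -- These coordinates are limits of coordinates of powers of `T`, which lie in `𝕜` and are fixed by
  -- the continuous map `algebraMap ∘ ρ`. No conjugation symmetry of the spectrum is needed.
  have hreal : ∀ v i, algebraMap 𝕜 ℂ (ρ (bW.repr (P (1 ⊗ₜ v)) i)) = bW.repr (P (1 ⊗ₜ v)) i := by
    intro v i
    have h1 := hk 1 one_ne_zero ((1 : ℂ) ⊗ₜ v) i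
    rw [pow_one] at h1
    have h2 := ((hιc.comp hρc).tendsto _).comp h1
    refine tendsto_nhds_unique h2 (h1.congr fun j => ?_)
    simp only [Function.comp_apply, hS, baseChange_pow_tmul, hrepr, mul_one, hρ]
  have hPT : P = Tinf.baseChange ℂ := by
    refine TensorProduct.AlgebraTensorModule.curry_injective (LinearMap.ext_ring ?_)
    refine LinearMap.ext fun v => ?_
    change P (1 ⊗ₜ v) = Tinf.baseChange ℂ ((1 : ℂ) ⊗ₜ v)
    rw [LinearMap.baseChange_tmul, hTinf]
    have hsum : ∀ w : ℂ ⊗[𝕜] V, (∀ i, algebraMap 𝕜 ℂ (ρ (bW.repr w i)) = bW.repr w i) →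
        w = (1 : ℂ) ⊗ₜ[𝕜] retraction ρ w := by
      intro w hw
      have h1 : w = ∑ i, (bW.repr w i) ⊗ₜ[𝕜] b i := by
        conv_lhs => rw [← bW.sum_repr w]
        refine Finset.sum_congr rfl fun i _ => ?_
        rw [Module.Basis.baseChange_apply, TensorProduct.smul_tmul', smul_eq_mul, mul_one]
      have h2 : retraction ρ w = ∑ i, ρ (bW.repr w i) • b i := by
        conv_lhs => rw [h1]
        rw [map_sum]
        exact Finset.sum_congr rfl fun i _ => retraction_tmul _ _ _
      rw [h2, TensorProduct.tmul_sum]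
      conv_lhs => rw [h1]
      refine Finset.sum_congr rfl fun i _ => ?_
      rw [← TensorProduct.smul_tmul, Algebra.smul_def, mul_one, hw]
    exact hsum _ (hreal v)
  have hinj : ∀ X Y : Module.End 𝕜 V, X.baseChange ℂ = Y.baseChange ℂ → X = Y := by
    intro X Y h
    refine LinearMap.ext fun v => ?_
    rw [← hretr (X v), ← hretr (Y v), ← LinearMap.baseChange_tmul, h, LinearMap.baseChange_tmul]
  refine ⟨fun m hm => ?_, ⟨hinj _ _ ?_, hinj _ _ ?_⟩, fun ν hν => hlt ν ?_⟩
  · have htend : Tendsto (fun j => N (T ^ (k j + m) - Tinf ^ m)) atTop (𝓝 0) := by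
      refine tendsto_seminorm_sub N (b.linearMap b) fun p => ?_
      have h1 := hk m hm ((1 : ℂ) ⊗ₜ b p.2) p.1
      have h2 := (hρc.tendsto _).comp h1
      simp only [Function.comp_def, hPT, hS, baseChange_pow_tmul, hrepr, mul_one, hρ] at h2
      have hlin : ∀ X : Module.End 𝕜 V, (b.linearMap b).repr X p = b.repr (X (b p.2)) p.1 := by
        intro X
        simp [Matrix.stdBasis, LinearMap.toMatrix_apply]
      simpa only [hlin] using h2
    have h3 : ∀ j, N (Tinf ^ m) ≤ C + N (T ^ (k j + m) - Tinf ^ m) := by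
      intro j
      have h4 := map_sub_le_add N (T ^ (k j + m)) (T ^ (k j + m) - Tinf ^ m)
      rw [sub_sub_cancel] at h4
      exact h4.trans (add_le_add_left (hT _) _)
    have h5 := htend.const_add C
    rw [add_zero] at h5
    exact ge_of_tendsto' h5 h3
  · rw [LinearMap.baseChange_mul, LinearMap.baseChange_mul, ← hPT]
    exact hP1
  · rw [LinearMap.baseChange_mul, LinearMap.baseChange_mul, ← hPT]
    exact hP2
  · rwa [hPT, hS, ← LinearMap.baseChange_sub]

end Transfer

/-! ### The main bound -/

section Scalars

variable (𝕜 : Type*) [RCLike 𝕜]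

theorem norm_toComplex (a : 𝕜) : ‖toComplex 𝕜 a‖ = ‖a‖ := by
  have h : ‖toComplex 𝕜 a‖ ^ 2 = ‖a‖ ^ 2 := by
    rw [RCLike.norm_sq_eq_def, RCLike.norm_sq_eq_def (z := a)]
    simp [toComplex]
  exact (sq_eq_sq₀ (norm_nonneg _) (norm_nonneg _)).1 h

theorem ofComplex_toComplex (a : 𝕜) : ofComplex 𝕜 (toComplex 𝕜 a) = a := by
  change RCLike.map ℂ 𝕜 (RCLike.map 𝕜 ℂ a) = a
  obtain h | h := RCLike.I_eq_zero_or_im_I_eq_one (K := 𝕜)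
  · apply RCLike.ext <;> simp [RCLike.im_eq_zero h]
  · apply RCLike.ext <;> simp

theorem continuous_ofComplex : Continuous (ofComplex 𝕜) :=
  (RCLike.map ℂ 𝕜).continuous

end Scalars

/-! ### Minimal polynomial, spectral radius and reduction to scalar sequences -/

section Main

variable {𝕜 : Type*} [RCLike 𝕜] {V : Type*} [AddCommGroup V] [Module 𝕜 V] [FiniteDimensional 𝕜 V]

theorem prod_minpolyRoots (A : Module.End 𝕜 V) :
    ((minpolyRoots A).map fun a => Polynomial.X - Polynomial.C a).prod =
      (minpoly 𝕜 A).map (toComplex 𝕜) := by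
  have hm : (minpoly 𝕜 A).Monic := minpoly.monic (Algebra.IsIntegral.isIntegral A)
  exact ((IsAlgClosed.splits _).eq_prod_roots_of_monic (hm.map _)).symm

theorem card_minpolyRoots (A : Module.End 𝕜 V) :
    (minpolyRoots A).card = (minpoly 𝕜 A).natDegree := by
  have h := congrArg Polynomial.natDegree (prod_minpolyRoots A)
  rwa [Polynomial.natDegree_multiset_prod_X_sub_C_eq_card, Polynomial.natDegree_map] at h

/-- The complex roots of the minimal polynomial are eigenvalues of the complexification. -/
theorem hasEigenvalue_of_mem_minpolyRoots (A : Module.End 𝕜 V) {a : ℂ} (ha : a ∈ minpolyRoots A) :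
    letI := complexAlgebra 𝕜
    Module.End.HasEigenvalue (A.baseChange ℂ : Module.End ℂ (ℂ ⊗[𝕜] V)) a := by
  let := complexAlgebra 𝕜
  rw [Module.End.hasEigenvalue_iff_isRoot_charpoly, LinearMap.charpoly_baseChange]
  refine Polynomial.IsRoot.dvd (Polynomial.isRoot_of_mem_roots ha) ?_
  exact Polynomial.map_dvd _ (LinearMap.minpoly_dvd_charpoly A)

/-- The orbit of a functional satisfies the recurrence given by the minimal polynomial. -/
theorem sum_coeff_mul_functional (A : Module.End 𝕜 V) (L : Module.End 𝕜 V →ₗ[𝕜] 𝕜) (t : ℕ) :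
    ∑ i ∈ Finset.range ((minpolyRoots A).card + 1),
      (((minpolyRoots A).map fun a => Polynomial.X - Polynomial.C a).prod).coeff i *
        toComplex 𝕜 (L (A ^ (i + t))) = 0 := by
  rw [prod_minpolyRoots, card_minpolyRoots]
  have h1 : ∑ i ∈ Finset.range ((minpoly 𝕜 A).natDegree + 1),
      (minpoly 𝕜 A).coeff i * L (A ^ (i + t)) = 0 := by
    have h2 : (∑ i ∈ Finset.range ((minpoly 𝕜 A).natDegree + 1),
        (minpoly 𝕜 A).coeff i • A ^ i) * A ^ t = 0 := by
      rw [← Polynomial.aeval_eq_sum_range, minpoly.aeval, zero_mul]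
    have h3 := congrArg L h2
    rw [Finset.sum_mul, map_sum, map_zero] at h3
    rw [← h3]
    refine Finset.sum_congr rfl fun i _ => ?_
    rw [smul_mul_assoc, ← pow_add, map_smul, smul_eq_mul]
  have h2 := congrArg (toComplex 𝕜) h1
  rw [map_sum, map_zero] at h2
  rw [← h2]
  refine Finset.sum_congr rfl fun i _ => ?_
  rw [Polynomial.coeff_map, map_mul]

/-- Hahn–Banach reduces this to a scalar sequence: a functional of norm at most one attains `N (A ^
n)`, and its values on the powers of `A` obey the recurrence. -/
theorem norm_pow_le_of_bounded (N : Seminorm 𝕜 (Module.End 𝕜 V))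
    (hN : ∀ X : Module.End 𝕜 V, N X = 0 → X = 0) {K : ℝ} {A : Module.End 𝕜 V}
    (hA : ∀ k, N (A ^ k) ≤ K) {μ : ℝ} (hμ0 : 0 < μ) (hμ1 : μ < 1)
    (hroots : ∀ a ∈ minpolyRoots A, ‖a‖ ≤ μ) (hcard : 0 < (minpolyRoots A).card)
    {n : ℕ} (hn : μ / (1 - μ) < n) :
    N (A ^ n) ≤ μ ^ (n + 1) *
        (2 * K * Real.exp 1 ^ 2 * √((minpolyRoots A).card : ℝ) * ((minpolyRoots A).card + 1) /
          (n * (1 - (1 + 1 / (n : ℝ)) * μ) ^ (3 / 2 : ℝ))) *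
        ⨆ z : Metric.sphere (0 : ℂ) (μ * (1 + 1 / (n : ℝ))), ‖1 / blaschke A z‖ := by
  obtain ⟨L, hL1, hL2⟩ := exists_dual_eq_seminorm N hN (A ^ n)
  have h := norm_le_of_recurrence hμ0 hμ1 hroots hcard hn
    (x := fun k => toComplex 𝕜 (L (A ^ k))) (K := K)
    (fun k => by rw [norm_toComplex]; exact (hL2 _).trans (hA k)) (sum_coeff_mul_functional A L)
  rw [norm_toComplex, hL1, RCLike.norm_ofReal, abs_of_nonneg (apply_nonneg N _)] at h
  exact h

/-- If all complex eigenvalues lie in the open unit disc and the spectral radius is positive, then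
it is less than one and bounds the roots of the minimal polynomial, which is not constant. -/
theorem specRadius_properties {A : Module.End 𝕜 V} (hpos : 0 < specRadius A)
    (hA : letI := complexAlgebra 𝕜
      ∀ ν, Module.End.HasEigenvalue (A.baseChange ℂ : Module.End ℂ (ℂ ⊗[𝕜] V)) ν → ‖ν‖ < 1) :
    specRadius A < 1 ∧ (∀ a ∈ minpolyRoots A, ‖a‖ ≤ specRadius A) ∧
      0 < (minpolyRoots A).card := by
  let := complexAlgebra 𝕜
  set S : Module.End ℂ (ℂ ⊗[𝕜] V) := A.baseChange ℂ with hS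
  have hspec : specRadius A = (spectralRadius ℂ S).toReal := rfl
  -- An empty spectrum would have spectral radius `0`, against `hpos`.
  have hne : (spectrum ℂ S).Nonempty := by
    by_contra h
    rw [Set.not_nonempty_iff_eq_empty] at h
    rw [hspec, spectralRadius, h] at hpos
    simp at hpos
  have hfin : (spectrum ℂ S).Finite := by
    refine S.finite_hasEigenvalue.subset fun ν hν => ?_
    exact Module.End.hasEigenvalue_iff_mem_spectrum.2 hν
  obtain ⟨κ, hκ, hmax⟩ := hfin.exists_maximalFor (fun ν => ‖ν‖₊) _ hne
  have hrad : spectralRadius ℂ S = ‖κ‖₊ := by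
    refine le_antisymm (iSup₂_le fun ν hν => ?_) (le_iSup₂ (f := fun ν (_ : ν ∈ spectrum ℂ S) =>
      ((‖ν‖₊ : NNReal) : ENNReal)) κ hκ)
    rcases le_total ‖ν‖₊ ‖κ‖₊ with h | h
    · exact_mod_cast h
    · exact_mod_cast hmax hν h
  have hrad' : specRadius A = ‖κ‖ := by
    rw [hspec, hrad]
    simp
  refine ⟨hrad' ▸ hA κ (Module.End.hasEigenvalue_iff_mem_spectrum.2 hκ), fun a ha => ?_, ?_⟩
  · have h1 := Module.End.hasEigenvalue_iff_mem_spectrum.1 (hasEigenvalue_of_mem_minpolyRoots A ha)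
    rw [hrad']
    rcases le_total ‖a‖₊ ‖κ‖₊ with h | h
    · exact h
    · exact hmax h1 h
  · rw [card_minpolyRoots]
    have : Nontrivial (Module.End 𝕜 V) := by
      by_contra h
      rw [not_nontrivial_iff_subsingleton] at h
      have h1 : (1 : Module.End 𝕜 V) = 0 := Subsingleton.elim _ _
      have h2 : (1 : Module.End ℂ (ℂ ⊗[𝕜] V)) = 0 := by
        rw [← LinearMap.baseChange_one, h1, LinearMap.baseChange_zero]
      have : Subsingleton (Module.End ℂ (ℂ ⊗[𝕜] V)) := subsingleton_of_zero_eq_one h2.symm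
      rw [spectrum.of_subsingleton] at hne
      exact Set.not_nonempty_empty hne
    exact minpoly.natDegree_pos (Algebra.IsIntegral.isIntegral A)

/-- The hypotheses say that `a - p` and `p` annihilate each other on both sides, so `a = (a - p) +
p` has no mixed terms in its powers. -/
theorem sub_pow_of_mul_eq {R : Type*} [Ring R] {a p : R} (h1 : a * p = p * p) (h2 : p * a = p * p)
    {k : ℕ} (hk : k ≠ 0) : (a - p) ^ k = a ^ k - p ^ k := by
  obtain ⟨k, rfl⟩ := Nat.exists_eq_succ_of_ne_zero hk
  clear hk
  induction k with
  | zero => simp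
  | succ k ih =>
    have h3 : ∀ j : ℕ, a ^ j * p = p ^ j * p := by
      intro j
      induction j with
      | zero => simp
      | succ j ihj => rw [pow_succ, mul_assoc, h1, ← mul_assoc, ihj, pow_succ]
    have h4 : p ^ (k + 1) * a = p ^ (k + 1) * p := by
      rw [pow_succ, mul_assoc, h2, ← mul_assoc]
    rw [Nat.succ_eq_add_one] at ih ⊢
    rw [pow_succ, ih, sub_mul, mul_sub, mul_sub, h3, h4, sub_self, sub_zero, ← pow_succ,
      ← pow_succ]

end Main

end BoundedSemigroup

end

open BoundedSemigroup in
theorem theorem4 {𝕜 : Type*} [RCLike 𝕜] {V : Type*} [AddCommGroup V] [Module 𝕜 V]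
    [FiniteDimensional 𝕜 V]
    (N : Seminorm 𝕜 (Module.End 𝕜 V)) (hN : ∀ X : Module.End 𝕜 V, N X = 0 → X = 0)
    (C : ℝ) (T : Module.End 𝕜 V) (hT : ∀ k : ℕ, N (T ^ k) ≤ C)
    (Tinf A : Module.End 𝕜 V) (hTinf : Tinf = asymptoticPart T) (hA : A = T - Tinf)
    (μ : ℝ) (hμ : μ = specRadius A) (hμ0 : 0 < μ)
    (d : ℕ) (hd : d = numLinearFactors A)
    (n : ℕ) (hn : μ / (1 - μ) < n) :
    N (T ^ n - Tinf ^ n) ≤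
      μ ^ (n + 1) *
        (4 * C * Real.exp 1 ^ 2 * √(d : ℝ) * (d + 1) /
          (n * (1 - (1 + 1 / (n : ℝ)) * μ) ^ (3 / 2 : ℝ))) *
        ⨆ z : Metric.sphere (0 : ℂ) (μ * (1 + 1 / (n : ℝ))), ‖1 / blaschke A z‖ := by
  let := complexAlgebra 𝕜
  obtain ⟨hbd, ⟨hc1, hc2⟩, hlt⟩ := asymptotic_properties (norm_toComplex 𝕜) (ofComplex 𝕜)
    (continuous_ofComplex 𝕜) (ofComplex_toComplex 𝕜) N hN C T Tinf hT
    (fun v => by rw [hTinf]; rfl)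
  rw [← hA] at hlt
  subst hμ hd
  obtain ⟨hμ1, hroots, hcard⟩ := specRadius_properties hμ0 hlt
  have hC : 0 ≤ C := (apply_nonneg N _).trans (hT 0)
  have hpow : ∀ k, k ≠ 0 → A ^ k = T ^ k - Tinf ^ k := fun k hk => by
    rw [hA, sub_pow_of_mul_eq hc1 hc2 hk]
  -- This `2` and the `2` from the `ℓ¹` estimate make up the `4` of the theorem. The power `k = 0`
  -- is separate, since there `A ^ k` is not the difference of powers.
  have hAbd : ∀ k, N (A ^ k) ≤ 2 * C := by
    intro k
    rcases eq_or_ne k 0 with rfl | hk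
    · have := hT 0
      rw [pow_zero] at this ⊢
      linarith
    · rw [hpow k hk]
      have := map_sub_le_add N (T ^ k) (Tinf ^ k)
      linarith [hT k, hbd k hk]
  have hn0 : n ≠ 0 := by
    rintro rfl
    have := div_pos hμ0 (sub_pos.2 hμ1)
    rw [Nat.cast_zero] at hn
    linarith
  have h := norm_pow_le_of_bounded N hN hAbd hμ0 hμ1 hroots hcard hn
  rw [hpow n hn0, show 2 * (2 * C) = 4 * C by ring] at h
  exact h
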